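/- Fix dimensions $d_x \ge 1$, $d_u$, and cost matrices $R_x \succeq I$ (symmetric, $d_x\times d_x$) and $R_u = I$ ($d_u \times d_u$). Consider the linear system $x_{t+1} = A x_t + B u_t + w_t$ with $x_1 = 0$ and $w_t$ i.i.d. $\mathcal N(0,I)$. A real square matrix is stable if its spectral radius is less than $1$; $(A,B)$ is stabilizable if $A+BK$ is stable for some $K$. For stabilizable $(A,B)$ let $P_\infty(A,B)$ be the unique positive semidefinite solution of the Riccati equation $$P = A^\top P A - A^\top P B (R_u + B^\top P B)^{-1} B^\top P A + R_x,$$ and let $K_\infty(A,B) = -(R_u + B^\top P_\infty(A,B) B)^{-1} B^\top P_\infty(A,B) A$. For a matrix $K$ let $$J_{A,B}[K] = \lim_{T\to\infty} \frac1T\, \mathbb E \sum_{t=1}^T \left(x_t^\top R_x x_t + u_t^\top R_u u_t\right) \quad\text{under } u_t = K x_t,$$ let $J^\star_{A,B} = \min_K J_{A,B}[K]$, and, when $A+BK$ is stable, let $P_\infty(K;A,B)$ be the unique positive semidefinite solution $P$ of $P = (A+BK)^\top P (A+BK) + R_x + K^\top R_u K$. Write $\|\cdot\|_{\mathrm{op}}$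 for the spectral norm, $\|\cdot\|_F$ for the Frobenius norm and $\preceq$ for the Loewner order. Theorem. There is a universal constant $C>0$ such that the following holds for all such $d_x, d_u, R_x$. Let $(A_\star,B_\star)$ be stabilizable, $P_\star = P_\infty(A_\star,B_\star)$, $K_\star = K_\infty(A_\star,B_\star)$, let $(\hat A,\hat B)$ be any pair of matrices of the same sizes, and for $\circ \in \{\mathrm{op},F\}$ put $\epsilon_\circ = \max\{\|\hat A - A_\star\|_\circ, \|\hat B - B_\star\|_\circ\}$. Assume $\epsilon_{\mathrm{op}} \le 1/(54\|P_\star\|_{\mathrm{op}}^5)$. Then $(\hat A,\hat B)$ is stabilizable and, with $\hat K = K_\infty(\hat A,\hat B)$, the matrix $A_\star + B_\star \hat K$ is stable (so that all objects below are well defined), and: 1. $\|P_\infty(\hat A,\hat B)\|_{\mathrm{op}} \le 1.0835\,\|P_\star\|_{\mathrm{op}}$, $\ \|B_\star(K_\star - \hat K)\|_{\mathrm{op}} < \dfrac{1}{5\|P_\star\|_{\mathrm{op}}^{3/2}}$, and $\|K_\star - \hat K\|_{\mathrm{op}} \le \dfrac{C}{\|P_\star\|_{\mathrm{op}}^{3/2}}$;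 2. $J_{A_\star,B_\star}[\hat K] - J^\star_{A_\star,B_\star} \le 142\,\|P_\star\|_{\mathrm{op}}^8\, \epsilon_F^2$; 3. $\|P_\infty(\hat K;A_\star,B_\star) - P_\star\|_{\mathrm{op}} \le 142\,\|P_\star\|_{\mathrm{op}}^8\, \epsilon_{\mathrm{op}}^2$; 4. $P_\infty(\hat K;A_\star,B_\star) \preceq \tfrac{21}{20} P_\star$. -/

import Mathlib

open MeasureTheory ProbabilityTheory Filter Topology
open scoped Matrix

namespace LQR

/-- The spectral norm (`ℓ²`-operator norm) of a real matrix. -/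
noncomputable def opNorm {a b : ℕ} (M : Matrix (Fin a) (Fin b) ℝ) : ℝ :=
  open scoped Matrix.Norms.L2Operator in ‖M‖

/-- The Frobenius norm of a real matrix. -/
noncomputable def frobNorm {a b : ℕ} (M : Matrix (Fin a) (Fin b) ℝ) : ℝ :=
  open scoped Matrix.Norms.Frobenius in ‖M‖

/-- The Loewner order `X ⪯ Y`: the difference `Y - X` is symmetric positive semidefinite. -/
def LoewnerLE {a : ℕ} (X Y : Matrix (Fin a) (Fin a) ℝ) : Prop :=
  (Y - X).PosSemidef

/-- A real square matrix is stable if its spectral radius (over its complex eigenvalues)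
is less than one. -/
def IsStable {a : ℕ} (M : Matrix (Fin a) (Fin a) ℝ) : Prop :=
  spectralRadius ℂ (M.map (fun x : ℝ => (x : ℂ))) < 1

/-- `(A, B)` is stabilizable if `A + B K` is stable for some feedback matrix `K`. -/
def Stabilizable {dx du : ℕ} (A : Matrix (Fin dx) (Fin dx) ℝ)
    (B : Matrix (Fin dx) (Fin du) ℝ) : Prop :=
  ∃ K : Matrix (Fin du) (Fin dx) ℝ, IsStable (A + B * K)

/-- `P` is a positive semidefinite solution of the discrete algebraic Riccati equation. -/
def IsDARESolution {dx du : ℕ} (Rx : Matrix (Fin dx) (Fin dx) ℝ)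
    (Ru : Matrix (Fin du) (Fin du) ℝ) (A : Matrix (Fin dx) (Fin dx) ℝ)
    (B : Matrix (Fin dx) (Fin du) ℝ) (P : Matrix (Fin dx) (Fin dx) ℝ) : Prop :=
  P.PosSemidef ∧
    P = Aᵀ * P * A - Aᵀ * P * B * (Ru + Bᵀ * P * B)⁻¹ * Bᵀ * P * A + Rx

/-- `P_∞(A, B)`: the positive semidefinite solution of the Riccati equation
(an arbitrary matrix if there is none). -/
noncomputable def Pinf {dx du : ℕ} (Rx : Matrix (Fin dx) (Fin dx) ℝ)
    (Ru : Matrix (Fin du) (Fin du) ℝ) (A : Matrix (Fin dx) (Fin dx) ℝ)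
    (B : Matrix (Fin dx) (Fin du) ℝ) : Matrix (Fin dx) (Fin dx) ℝ :=
  Classical.epsilon (IsDARESolution Rx Ru A B)

/-- `K_∞(A, B) = -(R_u + Bᵀ P_∞ B)⁻¹ Bᵀ P_∞ A`, the optimal infinite-horizon controller. -/
noncomputable def Kinf {dx du : ℕ} (Rx : Matrix (Fin dx) (Fin dx) ℝ)
    (Ru : Matrix (Fin du) (Fin du) ℝ) (A : Matrix (Fin dx) (Fin dx) ℝ)
    (B : Matrix (Fin dx) (Fin du) ℝ) : Matrix (Fin du) (Fin dx) ℝ :=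
  -((Ru + Bᵀ * Pinf Rx Ru A B * B)⁻¹ * Bᵀ * Pinf Rx Ru A B * A)

/-- `P` is a positive semidefinite solution of the discrete Lyapunov equation
`P = Xᵀ P X + Y`. -/
def IsLyapunovSolution {a : ℕ} (X Y P : Matrix (Fin a) (Fin a) ℝ) : Prop :=
  P.PosSemidef ∧ P = Xᵀ * P * X + Y

/-- `dlyap(X, Y)`: the positive semidefinite solution of the discrete Lyapunov equation
(an arbitrary matrix if there is none); used for stable `X` and positive semidefinite `Y`. -/
noncomputable def dlyap {a : ℕ} (X Y : Matrix (Fin a) (Fin a) ℝ) : Matrix (Fin a) (Fin a) ℝ :=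
  Classical.epsilon (IsLyapunovSolution X Y)

/-- `P_∞(K; A, B) = dlyap(A + B K, R_x + Kᵀ R_u K)`, the value matrix of the controller `K`. -/
noncomputable def PinfOf {dx du : ℕ} (Rx : Matrix (Fin dx) (Fin dx) ℝ)
    (Ru : Matrix (Fin du) (Fin du) ℝ) (A : Matrix (Fin dx) (Fin dx) ℝ)
    (B : Matrix (Fin dx) (Fin du) ℝ) (K : Matrix (Fin du) (Fin dx) ℝ) :
    Matrix (Fin dx) (Fin dx) ℝ :=
  dlyap (A + B * K) (Rx + Kᵀ * Ru * K)

/-- The law of the noise sequence: independent vectors `w_t ∼ N(0, I)` in dimension `dx`. -/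
noncomputable def noiseLaw (dx : ℕ) : Measure (ℕ → Fin dx → ℝ) :=
  Measure.infinitePi fun _ : ℕ => Measure.pi fun _ : Fin dx => gaussianReal 0 1

/-- The closed-loop trajectory under `u = K x`, started at `0`:
`x ↦ A x + B (K x) + w`. Time is counted from `0`. -/
noncomputable def state {dx du : ℕ} (A : Matrix (Fin dx) (Fin dx) ℝ)
    (B : Matrix (Fin dx) (Fin du) ℝ) (K : Matrix (Fin du) (Fin dx) ℝ)
    (w : ℕ → Fin dx → ℝ) : ℕ → Fin dx → ℝ
  | 0 => 0
  | t + 1 => A *ᵥ state A B K w t + B *ᵥ (K *ᵥ state A B K w t) + w t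

/-- The stage cost `c(x, u) = xᵀ R_x x + uᵀ R_u u`. -/
def stageCost {dx du : ℕ} (Rx : Matrix (Fin dx) (Fin dx) ℝ)
    (Ru : Matrix (Fin du) (Fin du) ℝ) (x : Fin dx → ℝ) (u : Fin du → ℝ) : ℝ :=
  x ⬝ᵥ (Rx *ᵥ x) + u ⬝ᵥ (Ru *ᵥ u)

/-- `J_{A,B}[K] = J`: the expected average cost of the policy `u = K x` over the first `T` steps
converges to the real number `J` as `T → ∞`. (The integrand is a quadratic polynomial in finitely
many Gaussian variables, hence integrable. A policy of infinite cost has no such `J`.) -/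
def HasAverageCost {dx du : ℕ} (Rx : Matrix (Fin dx) (Fin dx) ℝ)
    (Ru : Matrix (Fin du) (Fin du) ℝ) (A : Matrix (Fin dx) (Fin dx) ℝ)
    (B : Matrix (Fin dx) (Fin du) ℝ) (K : Matrix (Fin du) (Fin dx) ℝ) (J : ℝ) : Prop :=
  Tendsto
    (fun T : ℕ => (1 / (T : ℝ)) *
      ∫ w, ∑ t ∈ Finset.range T,
        stageCost Rx Ru (state A B K w t) (K *ᵥ state A B K w t) ∂(noiseLaw dx))
    atTop (𝓝 J)

/-- `J⋆_{A,B} = J`: the number `J` is the minimum of `J_{A,B}[K]` over all feedback matrices `K`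
(those of infinite cost do not compete). -/
def IsOptimalCost {dx du : ℕ} (Rx : Matrix (Fin dx) (Fin dx) ℝ)
    (Ru : Matrix (Fin du) (Fin du) ℝ) (A : Matrix (Fin dx) (Fin dx) ℝ)
    (B : Matrix (Fin dx) (Fin du) ℝ) (J : ℝ) : Prop :=
  IsLeast {J' : ℝ | ∃ K : Matrix (Fin du) (Fin dx) ℝ, HasAverageCost Rx Ru A B K J'} J

end LQR

/-! Everything is measured in the geometry of the value matrix. If $P = S^\top S$ solves the Riccati
equation with closed loop $L = A + BK$, then $L^\top P L + Y = P$ with $Y \succeq I \succeq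
P/\|P\|$, so $SLS^{-1}$ has norm at most $\sqrt{1 - 1/\|P\|}$ (`opNorm_conj_le`), while $\|S^{-1}\|
\le 1$ and $\|KS^{-1}\| \le 1$.

A priori bounds come from supersolutions. A slight inflation of $P_\star$ satisfies the Bellman
inequality of the nearby system under $K_\star$ (`IsDARESolution.policyMap_smul_le`); value
iteration from zero stays below it and converges to a Riccati solution (`exists_isDARESolution`).
Exchanging the two systems shows that $\hat K$ stabilizes the true system and bounds its value
matrix.

With both solutions bounded, `IsDARESolution.sub_eq` gives an exact identity $\Delta = L^\top \Delta
L' + O(\epsilon)$ for $\Delta = P' - P$. Normalizing by $S$ on the left and $S'$ on the right makes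
its linear part a contraction, so no path between the systems is needed. The optimality conditions
turn this into a bound on $T(K' - K)$, where $T^\top T = I + B^\top P B$
(`IsOperatorIdealNorm.perturbation`). Case $\epsilon = 0$ is uniqueness.

Completing the square, the excess value of $\hat K$ solves a Lyapunov equation with source $(T(\hat
K - K_\star))^\top T(\hat K - K_\star)$, hence is quadratic in $\epsilon$
(`IsDARESolution.value_sub_le`). Abstract ideal norms give the spectral and Frobenius versions from
one argument. Average costs are traces of value matrices because the noise covariance is the
identity. -/

namespace LQR

open scoped MatrixOrder

/-! ### Spectral and Frobenius norms against the Loewner order -/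

section Norms

variable {a b c : ℕ}

theorem opNorm_nonneg (X : Matrix (Fin a) (Fin b) ℝ) : 0 ≤ opNorm X := by
  open scoped Matrix.Norms.L2Operator in exact norm_nonneg X

theorem opNorm_mul_le (X : Matrix (Fin a) (Fin b) ℝ) (Y : Matrix (Fin b) (Fin c) ℝ) :
    opNorm (X * Y) ≤ opNorm X * opNorm Y := Matrix.l2_opNorm_mul X Y

theorem opNorm_add_le (X Y : Matrix (Fin a) (Fin b) ℝ) :
    opNorm (X + Y) ≤ opNorm X + opNorm Y := by
  open scoped Matrix.Norms.L2Operator in exact norm_add_le X Y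

theorem opNorm_neg (X : Matrix (Fin a) (Fin b) ℝ) : opNorm (-X) = opNorm X := by
  open scoped Matrix.Norms.L2Operator in exact norm_neg X

theorem opNorm_smul (r : ℝ) (X : Matrix (Fin a) (Fin b) ℝ) :
    opNorm (r • X) = |r| * opNorm X := by
  open scoped Matrix.Norms.L2Operator in exact norm_smul r X

theorem opNorm_eq_zero_iff (X : Matrix (Fin a) (Fin b) ℝ) : opNorm X = 0 ↔ X = 0 := by
  open scoped Matrix.Norms.L2Operator in exact norm_eq_zero

theorem opNorm_transpose (X : Matrix (Fin a) (Fin b) ℝ) : opNorm Xᵀ = opNorm X := by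
  rw [← Matrix.conjTranspose_eq_transpose_of_trivial]
  exact Matrix.l2_opNorm_conjTranspose X

theorem opNorm_transpose_mul_self (X : Matrix (Fin a) (Fin b) ℝ) :
    opNorm (Xᵀ * X) = opNorm X ^ 2 := by
  rw [← Matrix.conjTranspose_eq_transpose_of_trivial, sq]
  exact Matrix.l2_opNorm_conjTranspose_mul_self X

theorem posSemidef_transpose_mul_self (X : Matrix (Fin a) (Fin b) ℝ) : (Xᵀ * X).PosSemidef := by
  simpa using Matrix.posSemidef_conjTranspose_mul_self X

theorem transpose_mul_mul_nonneg {P : Matrix (Fin a) (Fin a) ℝ} (hP : 0 ≤ P)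
    (X : Matrix (Fin a) (Fin b) ℝ) : 0 ≤ Xᵀ * P * X := by
  simpa using ((Matrix.nonneg_iff_posSemidef.1 hP).conjTranspose_mul_mul_same X).nonneg

theorem transpose_mul_mul_mono {P Q : Matrix (Fin a) (Fin a) ℝ} (h : P ≤ Q)
    (X : Matrix (Fin a) (Fin b) ℝ) : Xᵀ * P * X ≤ Xᵀ * Q * X := by
  have := transpose_mul_mul_nonneg (sub_nonneg.2 h) X
  rwa [Matrix.mul_sub, Matrix.sub_mul, sub_nonneg] at this

theorem transpose_mul_self_nonneg (X : Matrix (Fin a) (Fin b) ℝ) : 0 ≤ Xᵀ * X :=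
  (posSemidef_transpose_mul_self X).nonneg

theorem smul_nonneg_of_nonneg {r : ℝ} (hr : 0 ≤ r) {P : Matrix (Fin a) (Fin a) ℝ} (hP : 0 ≤ P) :
    0 ≤ r • P := ((Matrix.nonneg_iff_posSemidef.1 hP).smul hr).nonneg

theorem smul_le_smul_left {r : ℝ} (hr : 0 ≤ r) {P Q : Matrix (Fin a) (Fin a) ℝ} (h : P ≤ Q) :
    r • P ≤ r • Q := by
  have := smul_nonneg_of_nonneg hr (sub_nonneg.2 h)
  rwa [smul_sub, sub_nonneg] at this

theorem smul_le_smul_right {r s : ℝ} (hr : r ≤ s) {P : Matrix (Fin a) (Fin a) ℝ} (h : 0 ≤ P) :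
    r • P ≤ s • P := by
  have := smul_nonneg_of_nonneg (sub_nonneg.2 hr) h
  rwa [sub_smul, sub_nonneg] at this

theorem zero_le_one_matrix : (0 : Matrix (Fin a) (Fin a) ℝ) ≤ 1 := Matrix.PosSemidef.one.nonneg

theorem transpose_eq_of_nonneg {P : Matrix (Fin a) (Fin a) ℝ} (hP : 0 ≤ P) : Pᵀ = P := by
  simpa using (Matrix.nonneg_iff_posSemidef.1 hP).isHermitian.eq

theorem trace_mono {P Q : Matrix (Fin a) (Fin a) ℝ} (h : P ≤ Q) : P.trace ≤ Q.trace := by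
  have := (Matrix.le_iff.1 h).trace_nonneg
  rwa [Matrix.trace_sub, sub_nonneg] at this

theorem le_iff_dotProduct {P Q : Matrix (Fin a) (Fin a) ℝ} (hP : Pᵀ = P) (hQ : Qᵀ = Q) :
    P ≤ Q ↔ ∀ v, v ⬝ᵥ P *ᵥ v ≤ v ⬝ᵥ Q *ᵥ v := by
  rw [Matrix.le_iff, Matrix.posSemidef_iff_dotProduct_mulVec]
  simp [Matrix.IsHermitian, hP, hQ, Matrix.sub_mulVec, dotProduct_sub]

theorem dotProduct_transpose_mul_self (X : Matrix (Fin a) (Fin b) ℝ) (v : Fin b → ℝ) :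
    v ⬝ᵥ (Xᵀ * X) *ᵥ v = (X *ᵥ v) ⬝ᵥ (X *ᵥ v) := by
  rw [← Matrix.mulVec_mulVec, Matrix.dotProduct_mulVec, Matrix.vecMul_transpose]

theorem norm_toLp_sq (v : Fin a → ℝ) : ‖WithLp.toLp 2 v‖ ^ 2 = v ⬝ᵥ v := by
  rw [EuclideanSpace.norm_sq_eq]
  simp [dotProduct, sq]

/-- A bound on the Gram matrix is a bound on the spectral norm. -/
theorem opNorm_le_of_transpose_mul_self_le {X : Matrix (Fin a) (Fin b) ℝ} {r : ℝ} (hr : 0 ≤ r)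
    (h : Xᵀ * X ≤ r ^ 2 • 1) : opNorm X ≤ r := by
  refine ContinuousLinearMap.opNorm_le_bound _ hr fun x => ?_
  rw [← sq_le_sq₀ (norm_nonneg _) (by positivity), mul_pow]
  have h2 := (le_iff_dotProduct (by simp) (by simp)).1 h x.ofLp
  rw [dotProduct_transpose_mul_self] at h2
  have h3 := norm_toLp_sq x.ofLp
  have h4 := norm_toLp_sq (X *ᵥ x.ofLp)
  simp only [Matrix.smul_mulVec, Matrix.one_mulVec, dotProduct_smul, smul_eq_mul] at h2
  rw [← h3, ← h4] at h2
  exact h2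

/-- A symmetric matrix is bounded above by its spectral norm. -/
theorem le_opNorm_smul_one {H : Matrix (Fin a) (Fin a) ℝ} (hH : Hᵀ = H) :
    H ≤ opNorm H • 1 := by
  rw [le_iff_dotProduct hH (by simp)]
  intro v
  have h1 : ‖WithLp.toLp 2 (H *ᵥ v)‖ ≤ opNorm H * ‖WithLp.toLp 2 v‖ :=
    Matrix.l2_opNorm_mulVec H (WithLp.toLp 2 v)
  have h2 := real_inner_le_norm (WithLp.toLp 2 (H *ᵥ v)) (WithLp.toLp 2 v)
  have h3 : inner ℝ (WithLp.toLp 2 (H *ᵥ v)) (WithLp.toLp 2 v) = v ⬝ᵥ H *ᵥ v := by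
    simp [EuclideanSpace.inner_eq_star_dotProduct]
  have h4 := norm_toLp_sq v
  simp only [Matrix.smul_mulVec, Matrix.one_mulVec, dotProduct_smul, smul_eq_mul]
  rw [← h4, ← h3]
  nlinarith [norm_nonneg (WithLp.toLp 2 v)]

theorem transpose_mul_self_le (X : Matrix (Fin a) (Fin b) ℝ) :
    Xᵀ * X ≤ opNorm X ^ 2 • 1 := by
  rw [← opNorm_transpose_mul_self]
  exact le_opNorm_smul_one (by simp)

theorem exists_eq_transpose_mul_self {P : Matrix (Fin a) (Fin a) ℝ} (hP : 0 ≤ P) :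
    ∃ S : Matrix (Fin a) (Fin a) ℝ, P = Sᵀ * S := by
  obtain ⟨S, hS⟩ := CStarAlgebra.nonneg_iff_eq_star_mul_self.mp hP
  exact ⟨S, by simpa [Matrix.star_eq_conjTranspose] using hS⟩

theorem opNorm_mono {P Q : Matrix (Fin a) (Fin a) ℝ} (hP : 0 ≤ P) (h : P ≤ Q) :
    opNorm P ≤ opNorm Q := by
  obtain ⟨S, rfl⟩ := exists_eq_transpose_mul_self hP
  have h1 := h.trans (le_opNorm_smul_one (transpose_eq_of_nonneg (hP.trans h)))
  rw [opNorm_transpose_mul_self, ← Real.le_sqrt (opNorm_nonneg _) (opNorm_nonneg _)]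
  refine opNorm_le_of_transpose_mul_self_le (Real.sqrt_nonneg _) ?_
  rwa [Real.sq_sqrt (opNorm_nonneg _)]

theorem opNorm_one_le : opNorm (1 : Matrix (Fin a) (Fin a) ℝ) ≤ 1 :=
  opNorm_le_of_transpose_mul_self_le zero_le_one (by simp)

theorem opNorm_sq_le {X : Matrix (Fin a) (Fin b) ℝ} {Q : Matrix (Fin b) (Fin b) ℝ}
    (h : Xᵀ * X ≤ Q) : opNorm X ^ 2 ≤ opNorm Q := by
  rw [← opNorm_transpose_mul_self]
  exact opNorm_mono (transpose_mul_self_nonneg X) h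

/-- An invertible `S` with `Xᵀ X ⪯ r² Sᵀ S` normalizes `X` to have norm at most `r`. -/
theorem opNorm_mul_inv_le {X : Matrix (Fin a) (Fin b) ℝ} {S : Matrix (Fin b) (Fin b) ℝ} {r : ℝ}
    (hr : 0 ≤ r) (hS : IsUnit S.det) (h : Xᵀ * X ≤ r ^ 2 • (Sᵀ * S)) : opNorm (X * S⁻¹) ≤ r := by
  refine opNorm_le_of_transpose_mul_self_le hr ?_
  have h1 := transpose_mul_mul_mono h S⁻¹
  have h2 : S⁻¹ᵀ * (r ^ 2 • (Sᵀ * S)) * S⁻¹ = r ^ 2 • 1 := by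
    rw [Matrix.mul_smul, Matrix.smul_mul, ← Matrix.mul_assoc, Matrix.mul_assoc,
      Matrix.mul_nonsing_inv _ hS, ← Matrix.transpose_mul, Matrix.mul_nonsing_inv _ hS]
    simp
  rw [h2] at h1
  rwa [Matrix.transpose_mul, Matrix.mul_assoc, ← Matrix.mul_assoc Xᵀ, ← Matrix.mul_assoc]

theorem isUnit_det_of_one_le {S : Matrix (Fin a) (Fin a) ℝ} (h : 1 ≤ Sᵀ * S) : IsUnit S.det := by
  have h1 : (Sᵀ * S).PosDef := by
    have := Matrix.PosDef.one.add_posSemidef (Matrix.le_iff.1 h)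
    simpa using this
  have := (Matrix.isUnit_iff_isUnit_det _).1 h1.isUnit
  rw [Matrix.det_mul] at this
  exact isUnit_of_mul_isUnit_right this

theorem opNorm_inv_le_one {S : Matrix (Fin a) (Fin a) ℝ} (h : 1 ≤ Sᵀ * S) : opNorm S⁻¹ ≤ 1 := by
  have := opNorm_mul_inv_le (X := (1 : Matrix (Fin a) (Fin a) ℝ)) zero_le_one
    (isUnit_det_of_one_le h) (by simpa using h)
  simpa using this

theorem frobNorm_nonneg (X : Matrix (Fin a) (Fin b) ℝ) : 0 ≤ frobNorm X := by
  open scoped Matrix.Norms.Frobenius in exact norm_nonneg X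

theorem frobNorm_add_le (X Y : Matrix (Fin a) (Fin b) ℝ) :
    frobNorm (X + Y) ≤ frobNorm X + frobNorm Y := by
  open scoped Matrix.Norms.Frobenius in exact norm_add_le X Y

theorem frobNorm_neg (X : Matrix (Fin a) (Fin b) ℝ) : frobNorm (-X) = frobNorm X := by
  open scoped Matrix.Norms.Frobenius in exact norm_neg X

theorem frobNorm_transpose (X : Matrix (Fin a) (Fin b) ℝ) : frobNorm Xᵀ = frobNorm X := by
  open scoped Matrix.Norms.Frobenius in exact Matrix.frobenius_norm_transpose X

theorem frobNorm_sq (X : Matrix (Fin a) (Fin b) ℝ) : frobNorm X ^ 2 = (Xᵀ * X).trace := by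
  have h : frobNorm X = √(∑ i, ∑ j, X i j ^ 2) := by
    open scoped Matrix.Norms.Frobenius in
    exact (Matrix.frobenius_norm_def X).trans (by simp [Real.sqrt_eq_rpow])
  rw [h, Real.sq_sqrt (by positivity), Finset.sum_comm]
  simp [Matrix.trace, Matrix.mul_apply, sq]

/-- Conjugate $X^\top X \preceq \|X\|^2 I$ by $Y$ and take traces. -/
theorem frobNorm_mul_le_opNorm_mul (X : Matrix (Fin a) (Fin b) ℝ) (Y : Matrix (Fin b) (Fin c) ℝ) :
    frobNorm (X * Y) ≤ opNorm X * frobNorm Y := by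
  rw [← sq_le_sq₀ (frobNorm_nonneg _) (mul_nonneg (opNorm_nonneg _) (frobNorm_nonneg _)), mul_pow,
    frobNorm_sq, frobNorm_sq]
  have := trace_mono (transpose_mul_mul_mono (transpose_mul_self_le X) Y)
  rwa [Matrix.mul_smul, Matrix.smul_mul, Matrix.mul_one, Matrix.trace_smul, smul_eq_mul,
    ← Matrix.mul_assoc, Matrix.mul_assoc, ← Matrix.transpose_mul] at this

theorem frobNorm_mul_le_mul_opNorm (X : Matrix (Fin a) (Fin b) ℝ) (Y : Matrix (Fin b) (Fin c) ℝ) :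
    frobNorm (X * Y) ≤ frobNorm X * opNorm Y := by
  rw [← frobNorm_transpose, Matrix.transpose_mul, ← frobNorm_transpose X, ← opNorm_transpose Y,
    mul_comm]
  exact frobNorm_mul_le_opNorm_mul _ _

/-- A family of matrix norms that is transpose invariant and submultiplicative with respect to
the spectral norm. -/
structure IsOperatorIdealNorm (N : ∀ {a b : ℕ}, Matrix (Fin a) (Fin b) ℝ → ℝ) : Prop where
  nonneg : ∀ {a b : ℕ} (X : Matrix (Fin a) (Fin b) ℝ), 0 ≤ N X
  add_le : ∀ {a b : ℕ} (X Y : Matrix (Fin a) (Fin b) ℝ), N (X + Y) ≤ N X + N Y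
  neg : ∀ {a b : ℕ} (X : Matrix (Fin a) (Fin b) ℝ), N (-X) = N X
  transpose : ∀ {a b : ℕ} (X : Matrix (Fin a) (Fin b) ℝ), N Xᵀ = N X
  mul_le_opNorm_mul : ∀ {a b c : ℕ} (X : Matrix (Fin a) (Fin b) ℝ) (Y : Matrix (Fin b) (Fin c) ℝ),
    N (X * Y) ≤ opNorm X * N Y
  mul_le_mul_opNorm : ∀ {a b c : ℕ} (X : Matrix (Fin a) (Fin b) ℝ) (Y : Matrix (Fin b) (Fin c) ℝ),
    N (X * Y) ≤ N X * opNorm Y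

theorem isOperatorIdealNorm_opNorm : IsOperatorIdealNorm opNorm :=
  ⟨opNorm_nonneg, opNorm_add_le, opNorm_neg, opNorm_transpose, opNorm_mul_le, opNorm_mul_le⟩

theorem isOperatorIdealNorm_frobNorm : IsOperatorIdealNorm frobNorm :=
  ⟨frobNorm_nonneg, frobNorm_add_le, frobNorm_neg, frobNorm_transpose, frobNorm_mul_le_opNorm_mul,
    frobNorm_mul_le_mul_opNorm⟩

end Norms

/-! ### Bellman operators, the Riccati map and value iteration -/

section Riccati

variable {dx du : ℕ}

/-- The Bellman operator of a fixed controller `K`, with control cost `R_u = I`. -/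
def policyMap (Rx : Matrix (Fin dx) (Fin dx) ℝ) (A : Matrix (Fin dx) (Fin dx) ℝ)
    (B : Matrix (Fin dx) (Fin du) ℝ) (K : Matrix (Fin du) (Fin dx) ℝ)
    (P : Matrix (Fin dx) (Fin dx) ℝ) : Matrix (Fin dx) (Fin dx) ℝ :=
  (A + B * K)ᵀ * P * (A + B * K) + (Rx + Kᵀ * K)

/-- The Riccati operator with control cost `R_u = I`. -/
noncomputable def riccatiMap (Rx : Matrix (Fin dx) (Fin dx) ℝ) (A : Matrix (Fin dx) (Fin dx) ℝ)
    (B : Matrix (Fin dx) (Fin du) ℝ) (P : Matrix (Fin dx) (Fin dx) ℝ) :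
    Matrix (Fin dx) (Fin dx) ℝ :=
  Aᵀ * P * A - Aᵀ * P * B * (1 + Bᵀ * P * B)⁻¹ * Bᵀ * P * A + Rx

/-- The greedy controller for the value matrix `P`. -/
noncomputable def gain (A : Matrix (Fin dx) (Fin dx) ℝ) (B : Matrix (Fin dx) (Fin du) ℝ)
    (P : Matrix (Fin dx) (Fin dx) ℝ) : Matrix (Fin du) (Fin dx) ℝ :=
  -((1 + Bᵀ * P * B)⁻¹ * Bᵀ * P * A)

variable {Rx A P Q : Matrix (Fin dx) (Fin dx) ℝ} {B : Matrix (Fin dx) (Fin du) ℝ}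

theorem posDef_one_add (hP : 0 ≤ P) (B : Matrix (Fin dx) (Fin du) ℝ) :
    (1 + Bᵀ * P * B).PosDef :=
  Matrix.PosDef.one.add_posSemidef
    (Matrix.nonneg_iff_posSemidef.1 (transpose_mul_mul_nonneg hP B))

theorem isUnit_det_one_add (hP : 0 ≤ P) (B : Matrix (Fin dx) (Fin du) ℝ) :
    IsUnit (1 + Bᵀ * P * B).det :=
  (Matrix.isUnit_iff_isUnit_det _).1 (posDef_one_add hP B).isUnit

theorem one_add_mul_gain (hP : 0 ≤ P) (A : Matrix (Fin dx) (Fin dx) ℝ)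
    (B : Matrix (Fin dx) (Fin du) ℝ) :
    (1 + Bᵀ * P * B) * gain A B P = -(Bᵀ * P * A) := by
  rw [gain, Matrix.mul_neg, Matrix.mul_assoc _ Bᵀ, Matrix.mul_assoc _ (Bᵀ * P),
    Matrix.mul_nonsing_inv_cancel_left _ _ (isUnit_det_one_add hP B)]

/-- The optimality condition `K + Bᵀ P (A + B K) = 0` of the greedy controller. -/
theorem gain_add_eq_zero (hP : 0 ≤ P) (A : Matrix (Fin dx) (Fin dx) ℝ)
    (B : Matrix (Fin dx) (Fin du) ℝ) :
    gain A B P + Bᵀ * P * (A + B * gain A B P) = 0 := by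
  have h := one_add_mul_gain hP A B
  rw [Matrix.add_mul, Matrix.one_mul, Matrix.mul_assoc _ B] at h
  rw [Matrix.mul_add, add_comm (Bᵀ * P * A), ← add_assoc, h, neg_add_cancel]

/-- Completing the square in the Bellman operator. -/
theorem policyMap_eq_riccatiMap_add (hP : 0 ≤ P) (Rx A : Matrix (Fin dx) (Fin dx) ℝ)
    (B : Matrix (Fin dx) (Fin du) ℝ) (K : Matrix (Fin du) (Fin dx) ℝ) :
    policyMap Rx A B K P = riccatiMap Rx A B P +
      (K - gain A B P)ᵀ * (1 + Bᵀ * P * B) * (K - gain A B P) := by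
  have h1 := one_add_mul_gain hP A B
  have hPt := transpose_eq_of_nonneg hP
  have h2 : (gain A B P)ᵀ * (1 + Bᵀ * P * B) = -(Aᵀ * P * B) := by
    have := congrArg Matrix.transpose h1
    simpa [Matrix.transpose_mul, hPt, Matrix.mul_assoc] using this
  have h3 : riccatiMap Rx A B P = Aᵀ * P * A + Aᵀ * P * B * gain A B P + Rx := by
    simp only [riccatiMap, gain, Matrix.mul_neg, Matrix.mul_assoc, sub_eq_add_neg]
  have h4 : (K - gain A B P)ᵀ * (1 + Bᵀ * P * B) * (K - gain A B P) =
      Kᵀ * K + Kᵀ * (Bᵀ * P * B) * K + Kᵀ * (Bᵀ * P * A) + Aᵀ * P * B * K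
        - Aᵀ * P * B * gain A B P := by
    rw [Matrix.transpose_sub, Matrix.sub_mul, h2, Matrix.sub_mul, Matrix.mul_sub, Matrix.mul_sub,
      Matrix.mul_assoc Kᵀ _ (gain A B P), h1]
    simp only [Matrix.mul_add, Matrix.add_mul, Matrix.mul_one, Matrix.mul_neg, Matrix.neg_mul]
    abel
  rw [h3, h4, policyMap]
  simp only [Matrix.transpose_add, Matrix.transpose_mul, Matrix.mul_add, Matrix.add_mul,
    Matrix.mul_assoc]
  abel

theorem riccatiMap_le_policyMap (hP : 0 ≤ P) (Rx A : Matrix (Fin dx) (Fin dx) ℝ)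
    (B : Matrix (Fin dx) (Fin du) ℝ) (K : Matrix (Fin du) (Fin dx) ℝ) :
    riccatiMap Rx A B P ≤ policyMap Rx A B K P := by
  rw [policyMap_eq_riccatiMap_add hP]
  exact le_add_of_nonneg_right
    (transpose_mul_mul_nonneg (posDef_one_add hP B).posSemidef.nonneg _)

theorem riccatiMap_eq_policyMap (hP : 0 ≤ P) (Rx A : Matrix (Fin dx) (Fin dx) ℝ)
    (B : Matrix (Fin dx) (Fin du) ℝ) :
    riccatiMap Rx A B P = policyMap Rx A B (gain A B P) P := by
  rw [policyMap_eq_riccatiMap_add hP]; simp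

theorem policyMap_mono (h : P ≤ Q) (Rx A : Matrix (Fin dx) (Fin dx) ℝ)
    (B : Matrix (Fin dx) (Fin du) ℝ) (K : Matrix (Fin du) (Fin dx) ℝ) :
    policyMap Rx A B K P ≤ policyMap Rx A B K Q :=
  add_le_add_left (transpose_mul_mul_mono h _) _

theorem policyMap_nonneg (hR : 0 ≤ Rx) (hP : 0 ≤ P) (A : Matrix (Fin dx) (Fin dx) ℝ)
    (B : Matrix (Fin dx) (Fin du) ℝ) (K : Matrix (Fin du) (Fin dx) ℝ) :
    0 ≤ policyMap Rx A B K P :=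
  add_nonneg (transpose_mul_mul_nonneg hP _) (add_nonneg hR (transpose_mul_self_nonneg K))

/-- The Riccati map is the minimum over `K` of the monotone maps `policyMap`; the greedy controller
of `Q` serves as a competitor at `P`. -/
theorem riccatiMap_mono (hP : 0 ≤ P) (h : P ≤ Q) (Rx A : Matrix (Fin dx) (Fin dx) ℝ)
    (B : Matrix (Fin dx) (Fin du) ℝ) : riccatiMap Rx A B P ≤ riccatiMap Rx A B Q := by
  rw [riccatiMap_eq_policyMap (hP.trans h)]
  exact (riccatiMap_le_policyMap hP _ _ _ _).trans (policyMap_mono h _ _ _ _)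

theorem riccatiMap_nonneg (hR : 0 ≤ Rx) (hP : 0 ≤ P) (A : Matrix (Fin dx) (Fin dx) ℝ)
    (B : Matrix (Fin dx) (Fin du) ℝ) : 0 ≤ riccatiMap Rx A B P := by
  rw [riccatiMap_eq_policyMap hP]
  exact policyMap_nonneg hR hP _ _ _

theorem isDARESolution_iff : IsDARESolution Rx 1 A B P ↔ 0 ≤ P ∧ riccatiMap Rx A B P = P := by
  rw [IsDARESolution, Matrix.nonneg_iff_posSemidef, riccatiMap, eq_comm]

theorem IsDARESolution.nonneg (h : IsDARESolution Rx 1 A B P) : 0 ≤ P := h.1.nonneg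

/-- The policy evaluation identity of the optimal controller. -/
theorem IsDARESolution.policyMap_gain (h : IsDARESolution Rx 1 A B P) :
    policyMap Rx A B (gain A B P) P = P := by
  rw [← riccatiMap_eq_policyMap h.nonneg, (isDARESolution_iff.1 h).2]

/-- Value iteration from the zero matrix. -/
noncomputable def riccatiIter (Rx A : Matrix (Fin dx) (Fin dx) ℝ) (B : Matrix (Fin dx) (Fin du) ℝ)
    (k : ℕ) : Matrix (Fin dx) (Fin dx) ℝ :=
  (riccatiMap Rx A B)^[k] 0

theorem riccatiIter_succ (Rx A : Matrix (Fin dx) (Fin dx) ℝ) (B : Matrix (Fin dx) (Fin du) ℝ)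
    (k : ℕ) : riccatiIter Rx A B (k + 1) = riccatiMap Rx A B (riccatiIter Rx A B k) :=
  Function.iterate_succ_apply' _ _ _

theorem riccatiIter_nonneg (hR : 0 ≤ Rx) (A : Matrix (Fin dx) (Fin dx) ℝ)
    (B : Matrix (Fin dx) (Fin du) ℝ) (k : ℕ) : 0 ≤ riccatiIter Rx A B k := by
  induction k with
  | zero => exact le_refl _
  | succ k ih => rw [riccatiIter_succ]; exact riccatiMap_nonneg hR ih _ _

theorem riccatiIter_mono (hR : 0 ≤ Rx) (A : Matrix (Fin dx) (Fin dx) ℝ)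
    (B : Matrix (Fin dx) (Fin du) ℝ) : Monotone (riccatiIter Rx A B) := by
  refine monotone_nat_of_le_succ fun k => ?_
  induction k with
  | zero => exact riccatiIter_nonneg hR A B 1
  | succ k ih =>
    rw [riccatiIter_succ, riccatiIter_succ _ _ _ (k + 1)]
    exact riccatiMap_mono (riccatiIter_nonneg hR A B k) ih _ _ _

/-- A supersolution for one controller is one for the Riccati map, which minimizes over controllers,
and monotonicity propagates the bound. -/
theorem riccatiIter_le (hR : 0 ≤ Rx) {U : Matrix (Fin dx) (Fin dx) ℝ} (hU0 : 0 ≤ U)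
    {K : Matrix (Fin du) (Fin dx) ℝ} (hU : policyMap Rx A B K U ≤ U) (k : ℕ) :
    riccatiIter Rx A B k ≤ U := by
  induction k with
  | zero => exact hU0
  | succ k ih =>
    rw [riccatiIter_succ]
    exact ((riccatiMap_mono (riccatiIter_nonneg hR A B k) ih _ _ _).trans
      (riccatiMap_le_policyMap hU0 _ _ _ K)).trans hU

theorem le_of_tendsto_matrix {f : ℕ → Matrix (Fin dx) (Fin dx) ℝ} (hf : ∀ k, 0 ≤ f k)
    (hP : Tendsto f atTop (𝓝 P)) : 0 ≤ P := by
  have hPt : Pᵀ = P := by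
    refine tendsto_nhds_unique ?_ hP
    have : Continuous fun X : Matrix (Fin dx) (Fin dx) ℝ => Xᵀ := by fun_prop
    refine ((this.tendsto P).comp hP).congr fun k => ?_
    exact transpose_eq_of_nonneg (hf k)
  rw [le_iff_dotProduct (by simp) hPt]
  intro v
  have hc : Continuous fun X : Matrix (Fin dx) (Fin dx) ℝ => v ⬝ᵥ X *ᵥ v := by fun_prop
  refine ge_of_tendsto' ((hc.tendsto P).comp hP) fun k => ?_
  exact (le_iff_dotProduct (by simp) (transpose_eq_of_nonneg (hf k))).1 (hf k) v

/-- Each quadratic form is a bounded monotone real sequence, and polarization recovers the entries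
of the symmetric matrices. -/
theorem tendsto_of_monotone_of_le {f : ℕ → Matrix (Fin dx) (Fin dx) ℝ} (hf0 : ∀ k, 0 ≤ f k)
    (hf : Monotone f) {U : Matrix (Fin dx) (Fin dx) ℝ} (hU : ∀ k, f k ≤ U) :
    ∃ P, Tendsto f atTop (𝓝 P) := by
  have hUt := transpose_eq_of_nonneg ((hf0 0).trans (hU 0))
  have hft := fun k => transpose_eq_of_nonneg (hf0 k)
  have hq : ∀ v, ∃ l : ℝ, Tendsto (fun k => v ⬝ᵥ f k *ᵥ v) atTop (𝓝 l) := by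
    intro v
    refine ⟨_, tendsto_atTop_ciSup (f := fun k => v ⬝ᵥ f k *ᵥ v) ?_ ?_⟩
    · exact fun i j hij => (le_iff_dotProduct (hft i) (hft j)).1 (hf hij) v
    · exact ⟨v ⬝ᵥ U *ᵥ v, by
        rintro _ ⟨k, rfl⟩; exact (le_iff_dotProduct (hft k) hUt).1 (hU k) v⟩
  choose q hq using hq
  let e : Fin dx → Fin dx → ℝ := fun i => Pi.single i 1
  refine ⟨fun i j => (q (e i + e j) - q (e i) - q (e j)) / 2, ?_⟩
  refine tendsto_pi_nhds.2 fun i => tendsto_pi_nhds.2 fun j => ?_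
  refine ((((hq (e i + e j)).sub (hq (e i))).sub (hq (e j))).div_const 2).congr fun k => ?_
  have hs : f k j i = f k i j := congrFun (congrFun (hft k) i) j
  simp [e, Matrix.mulVec_add, add_dotProduct, dotProduct_add, hs]
  ring

theorem continuousAt_riccatiMap (hP : 0 ≤ P) (Rx A : Matrix (Fin dx) (Fin dx) ℝ)
    (B : Matrix (Fin dx) (Fin du) ℝ) : ContinuousAt (riccatiMap Rx A B) P := by
  have hmul : ∀ {m n k : ℕ} {f : Matrix (Fin dx) (Fin dx) ℝ → Matrix (Fin m) (Fin n) ℝ}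
      {g : Matrix (Fin dx) (Fin dx) ℝ → Matrix (Fin n) (Fin k) ℝ}, ContinuousAt f P →
      ContinuousAt g P → ContinuousAt (fun P => f P * g P) P := fun {m n k f g} hf hg =>
    Filter.Tendsto.comp ((continuous_fst.matrix_mul continuous_snd).continuousAt
      (x := (f P, g P))) (hf.prodMk hg)
  -- The inverse is the adjugate over the determinant, which is nonzero at the positive semidefinite
  -- `P`.
  have hinv : ContinuousAt (fun P : Matrix (Fin dx) (Fin dx) ℝ => (1 + Bᵀ * P * B)⁻¹) P := by
    have hdet : Continuous fun P : Matrix (Fin dx) (Fin dx) ℝ => (1 + Bᵀ * P * B).det := by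
      fun_prop
    have hadj : Continuous fun P : Matrix (Fin dx) (Fin dx) ℝ => (1 + Bᵀ * P * B).adjugate := by
      fun_prop
    have := (hdet.continuousAt.inv₀ (isUnit_det_one_add hP B).ne_zero).smul
      (hadj.continuousAt (x := P))
    simp only [Matrix.inv_def, Ring.inverse_eq_inv']
    exact this
  have hsand : ∀ {m n : ℕ} (X : Matrix (Fin m) (Fin dx) ℝ) (Y : Matrix (Fin dx) (Fin n) ℝ),
      ContinuousAt (fun P : Matrix (Fin dx) (Fin dx) ℝ => X * P * Y) P := fun X Y =>
    hmul (hmul continuousAt_const continuousAt_id) continuousAt_const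
  have h := ((hsand Aᵀ A).sub (hmul (hmul (hsand Aᵀ B) hinv) (hsand Bᵀ A))).add
    (continuousAt_const (y := Rx))
  refine h.congr (Eventually.of_forall fun X => ?_)
  simp only [riccatiMap, Matrix.mul_assoc, Pi.add_apply, Pi.sub_apply]

/-- A supersolution of the Bellman inequality yields convergence of value iteration to a
Riccati solution below it. -/
theorem exists_isDARESolution (hR : 0 ≤ Rx) {U : Matrix (Fin dx) (Fin dx) ℝ} (hU0 : 0 ≤ U)
    {K : Matrix (Fin du) (Fin dx) ℝ} (hU : policyMap Rx A B K U ≤ U) :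
    ∃ P, IsDARESolution Rx 1 A B P ∧ P ≤ U ∧ Tendsto (riccatiIter Rx A B) atTop (𝓝 P) := by
  obtain ⟨P, hP⟩ := tendsto_of_monotone_of_le (riccatiIter_nonneg hR A B)
    (riccatiIter_mono hR A B) (riccatiIter_le hR hU0 hU)
  have hP0 := le_of_tendsto_matrix (riccatiIter_nonneg hR A B) hP
  refine ⟨P, isDARESolution_iff.2 ⟨hP0, ?_⟩, ?_, hP⟩
  · refine tendsto_nhds_unique ((continuousAt_riccatiMap hP0 Rx A B).tendsto.comp hP) ?_
    refine ((tendsto_add_atTop_iff_nat 1).2 hP).congr fun k => ?_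
    exact riccatiIter_succ _ _ _ _
  · refine sub_nonneg.1 (le_of_tendsto_matrix (f := fun k => U - riccatiIter Rx A B k) ?_
      (tendsto_const_nhds.sub hP))
    exact fun k => sub_nonneg.2 (riccatiIter_le hR hU0 hU k)

/-! ### Lyapunov equations and finite-horizon values -/

variable {X Y : Matrix (Fin dx) (Fin dx) ℝ}

/-- A Lyapunov equation is a Riccati equation without control. -/
theorem isLyapunovSolution_iff_isDARESolution :
    IsLyapunovSolution X Y P ↔
      IsDARESolution Y 1 X (0 : Matrix (Fin dx) (Fin 0) ℝ) P := by
  simp [IsLyapunovSolution, IsDARESolution]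

/-- The finite-horizon values of the Lyapunov recursion. -/
def lyapunovIter (X Y : Matrix (Fin dx) (Fin dx) ℝ) : ℕ → Matrix (Fin dx) (Fin dx) ℝ
  | 0 => 0
  | k + 1 => Xᵀ * lyapunovIter X Y k * X + Y

theorem lyapunovIter_eq_riccatiIter (X Y : Matrix (Fin dx) (Fin dx) ℝ) (k : ℕ) :
    lyapunovIter X Y k = riccatiIter Y X (0 : Matrix (Fin dx) (Fin 0) ℝ) k := by
  induction k with
  | zero => rfl
  | succ k ih => rw [riccatiIter_succ, ← ih]; simp [lyapunovIter, riccatiMap]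

theorem exists_isLyapunovSolution (hY : 0 ≤ Y) {U : Matrix (Fin dx) (Fin dx) ℝ} (hU0 : 0 ≤ U)
    (hU : Xᵀ * U * X + Y ≤ U) :
    ∃ P, IsLyapunovSolution X Y P ∧ P ≤ U ∧ Tendsto (lyapunovIter X Y) atTop (𝓝 P) := by
  obtain ⟨P, h1, h2, h3⟩ := exists_isDARESolution (A := X)
    (B := (0 : Matrix (Fin dx) (Fin 0) ℝ)) (K := 0) hY hU0 (by simpa [policyMap] using hU)
  exact ⟨P, isLyapunovSolution_iff_isDARESolution.2 h1, h2,
    h3.congr fun k => (lyapunovIter_eq_riccatiIter X Y k).symm⟩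

/-- The finite-horizon value of any controller dominates value iteration. -/
theorem riccatiIter_le_lyapunovIter (hR : 0 ≤ Rx) (A : Matrix (Fin dx) (Fin dx) ℝ)
    (B : Matrix (Fin dx) (Fin du) ℝ) (K : Matrix (Fin du) (Fin dx) ℝ) (k : ℕ) :
    riccatiIter Rx A B k ≤ lyapunovIter (A + B * K) (Rx + Kᵀ * K) k := by
  induction k with
  | zero => exact le_refl _
  | succ k ih =>
    rw [riccatiIter_succ]
    exact (riccatiMap_le_policyMap (riccatiIter_nonneg hR A B k) _ _ _ K).trans
      (policyMap_mono ih _ _ _ _)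

end Riccati

/-! ### Stability, vanishing powers and Lyapunov inequalities -/

section Stability

variable {a : ℕ} {X Y U : Matrix (Fin a) (Fin a) ℝ}

/-- Gelfand's formula in one direction, $\rho(Z) \le \|Z^{n+1}\|^{1/(n+1)}$ in the other.
Complexification does not affect convergence of powers. -/
theorem isStable_iff_tendsto_pow :
    IsStable X ↔ Tendsto (fun n => X ^ n) atTop (𝓝 0) := by
  open scoped Matrix.Norms.L2Operator in
  set Z : Matrix (Fin a) (Fin a) ℂ := X.map (fun x : ℝ => (x : ℂ)) with hZ
  have hpow : ∀ n, Z ^ n = (X ^ n).map (fun x : ℝ => (x : ℂ)) := fun n =>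
    (map_pow (Complex.ofRealHom.mapMatrix (m := Fin a)) X n).symm
  have hc1 : Continuous fun M : Matrix (Fin a) (Fin a) ℝ => M.map (fun x : ℝ => (x : ℂ)) :=
    continuous_id.matrix_map Complex.continuous_ofReal
  have hc2 : Continuous fun M : Matrix (Fin a) (Fin a) ℂ => M.map Complex.re :=
    continuous_id.matrix_map Complex.continuous_re
  have key : Tendsto (fun n => X ^ n) atTop (𝓝 0) ↔ Tendsto (fun n => Z ^ n) atTop (𝓝 0) := by
    constructor
    · intro h
      have := (hc1.tendsto 0).comp h
      simp only [Matrix.map_zero _ Complex.ofReal_zero] at this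
      exact this.congr fun n => (hpow n).symm
    · intro h
      have := (hc2.tendsto 0).comp h
      simp only [Matrix.map_zero _ Complex.zero_re] at this
      refine this.congr fun n => ?_
      ext i j
      simp [hpow n]
  rw [key, IsStable, ← hZ]
  constructor
  · intro h
    obtain ⟨c, hc, hc1⟩ := exists_between h
    rw [tendsto_zero_iff_norm_tendsto_zero]
    suffices hlim : Tendsto (fun n => (‖Z ^ n‖₊ : ENNReal)) atTop (𝓝 ((0 : NNReal) : ENNReal)) from
      NNReal.tendsto_coe.2 (ENNReal.tendsto_coe.1 hlim)
    have hev := (spectrum.pow_nnnorm_pow_one_div_tendsto_nhds_spectralRadius Z).eventually_lt_const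
      hc
    refine tendsto_of_tendsto_of_tendsto_of_le_of_le' tendsto_const_nhds
      (ENNReal.tendsto_pow_atTop_nhds_zero_of_lt_one hc1) (Eventually.of_forall fun _ => zero_le)
      ?_
    filter_upwards [hev, eventually_gt_atTop 0] with n hn hn0
    rw [one_div, ENNReal.rpow_inv_lt_iff (by positivity), ENNReal.rpow_natCast] at hn
    exact hn.le
  · intro h
    -- In dimension zero the identity has norm $0$, so the bound through $\|1\| = 1$ is unavailable.
    rcases subsingleton_or_nontrivial (Matrix (Fin a) (Fin a) ℂ) with hs | hs
    · simp [spectrum.SpectralRadius.of_subsingleton]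
    · have h1 := ((tendsto_add_atTop_iff_nat 1).2 h).norm
      rw [norm_zero] at h1
      obtain ⟨n, hn⟩ := (h1.eventually_lt_const one_pos).exists
      refine (spectrum.spectralRadius_le_pow_nnnorm_pow_one_div ℂ Z n).trans_lt ?_
      rw [nnnorm_one, ENNReal.coe_one, ENNReal.one_rpow, mul_one]
      exact ENNReal.rpow_lt_one (by exact_mod_cast hn) (by positivity)

theorem tendsto_opNorm_zero_iff {f : ℕ → Matrix (Fin a) (Fin a) ℝ} :
    Tendsto f atTop (𝓝 0) ↔ Tendsto (fun n => opNorm (f n)) atTop (𝓝 0) := by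
  open scoped Matrix.Norms.L2Operator in
  exact tendsto_zero_iff_norm_tendsto_zero

/-- A Lyapunov inequality makes `X` a contraction in the norm of a square root of `U`. -/
theorem opNorm_conj_le {S : Matrix (Fin a) (Fin a) ℝ} {q : ℝ} (hq : 1 ≤ q)
    (hS : opNorm S ^ 2 ≤ q) (h1 : 1 ≤ Sᵀ * S) (hY : 1 ≤ Y)
    (h : Xᵀ * (Sᵀ * S) * X + Y ≤ Sᵀ * S) : opNorm (S * X * S⁻¹) ≤ √(1 - 1 / q) := by
  have hq0 : 0 < q := by linarith
  have hq1 : 0 ≤ 1 - 1 / q := by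
    rw [sub_nonneg, div_le_one hq0]; exact hq
  refine opNorm_mul_inv_le (Real.sqrt_nonneg _) (isUnit_det_of_one_le h1) ?_
  rw [Real.sq_sqrt hq1, sub_smul, one_smul]
  -- Since $S^\top S \preceq qI \preceq qY$, subtracting $Y$ removes at least the fraction $1/q$ of
  -- $S^\top S$.
  have h2 : (1 / q) • (Sᵀ * S) ≤ 1 := by
    have := smul_le_smul_left (r := 1 / q) (by positivity)
      ((transpose_mul_self_le S).trans (smul_le_smul_right hS zero_le_one_matrix))
    rwa [smul_smul, one_div, inv_mul_cancel₀ hq0.ne', one_smul, ← one_div] at this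
  have h3 : (S * X)ᵀ * (S * X) = Xᵀ * (Sᵀ * S) * X := by
    simp only [Matrix.transpose_mul, Matrix.mul_assoc]
  rw [h3, le_sub_iff_add_le]
  exact (add_le_add_right (h2.trans hY) _).trans h

theorem opNorm_pow_le (X : Matrix (Fin a) (Fin a) ℝ) (n : ℕ) : opNorm (X ^ n) ≤ opNorm X ^ n := by
  induction n with
  | zero => simpa using opNorm_one_le
  | succ n ih =>
    rw [pow_succ, pow_succ]
    exact (opNorm_mul_le _ _).trans (mul_le_mul_of_nonneg_right ih (opNorm_nonneg _))

theorem isStable_of_lyapunov_le (hU : 0 ≤ U) (hY : 1 ≤ Y) (h : Xᵀ * U * X + Y ≤ U) :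
    IsStable X := by
  rw [isStable_iff_tendsto_pow, tendsto_opNorm_zero_iff]
  have hU1 : 1 ≤ U := hY.trans ((le_add_of_nonneg_left (transpose_mul_mul_nonneg hU X)).trans h)
  obtain ⟨S, rfl⟩ := exists_eq_transpose_mul_self hU
  have hdet := isUnit_det_of_one_le hU1
  -- The maximum with $1$ matters only in dimension zero.
  set q := max 1 (opNorm S ^ 2)
  have hq : 1 ≤ q := le_max_left _ _
  have hc := opNorm_conj_le hq (le_max_right _ _) hU1 hY h
  set r := √(1 - 1 / q)
  have hr : r < 1 := by
    rw [Real.sqrt_lt' one_pos]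
    have : 0 < 1 / q := by positivity
    linarith
  have hpow : ∀ n : ℕ, X ^ n = S⁻¹ * (S * X * S⁻¹) ^ n * S := by
    intro n
    induction n with
    | zero => simp [Matrix.nonsing_inv_mul _ hdet]
    | succ n ih =>
      rw [pow_succ, ih, pow_succ]
      simp only [Matrix.mul_assoc, Matrix.nonsing_inv_mul _ hdet, Matrix.mul_one]
  have hlim : Tendsto (fun n : ℕ => opNorm S⁻¹ * r ^ n * opNorm S) atTop (𝓝 0) := by
    have := ((tendsto_pow_atTop_nhds_zero_of_lt_one (Real.sqrt_nonneg _) hr).const_mul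
      (opNorm S⁻¹)).mul_const (opNorm S)
    rwa [mul_zero, zero_mul] at this
  refine squeeze_zero (fun n => opNorm_nonneg _) (fun n => ?_) hlim
  rw [hpow n]
  refine (opNorm_mul_le _ _).trans (mul_le_mul_of_nonneg_right ?_ (opNorm_nonneg _))
  refine (opNorm_mul_le _ _).trans (mul_le_mul_of_nonneg_left ?_ (opNorm_nonneg _))
  exact (opNorm_pow_le _ _).trans (pow_le_pow_left₀ (opNorm_nonneg _) hc n)

/-- A finite sum suffices: once $\|X^n\| < 1$, the partial sum $W = \sum_{j<n} (X^j)^\top X^j$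
telescopes to $X^\top W X \preceq W - (1 - \|X^n\|^2) I$, and scaling $W$ absorbs $Y$. -/
theorem exists_lyapunov_le (hX : IsStable X) (hY : 0 ≤ Y) : ∃ U, 0 ≤ U ∧ Xᵀ * U * X + Y ≤ U := by
  rw [isStable_iff_tendsto_pow, tendsto_opNorm_zero_iff] at hX
  obtain ⟨n, hn⟩ := (hX.eventually_lt_const one_pos).exists
  set c := opNorm (X ^ n) ^ 2 with hc
  have hc1 : c < 1 := by
    rw [hc, sq_lt_one_iff₀ (opNorm_nonneg _)]; exact hn
  set W := ∑ j ∈ Finset.range n, (X ^ j)ᵀ * X ^ j with hW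
  have hW0 : 0 ≤ W := Finset.sum_nonneg fun j _ => transpose_mul_self_nonneg _
  have hXW : Xᵀ * W * X + 1 = W + (X ^ n)ᵀ * X ^ n := by
    rw [hW, ← Finset.sum_range_succ, Finset.sum_range_succ', Finset.mul_sum, Finset.sum_mul]
    simp [pow_succ, Matrix.transpose_mul, Matrix.mul_assoc]
  set r := opNorm Y / (1 - c)
  have hr : 0 ≤ r := div_nonneg (opNorm_nonneg _) (by linarith)
  have hry : r * (1 - c) = opNorm Y := div_mul_cancel₀ _ (by linarith)
  refine ⟨r • W, smul_nonneg_of_nonneg hr hW0, ?_⟩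
  have h1 : Xᵀ * W * X ≤ W - (1 - c) • 1 := by
    have h2 := transpose_mul_self_le (X ^ n)
    rw [eq_sub_of_add_eq hXW, sub_smul, one_smul, sub_sub_eq_add_sub]
    exact sub_le_sub_right (add_le_add_right h2 _) _
  have h3 := smul_le_smul_left hr h1
  rw [smul_sub, smul_smul, hry, le_sub_iff_add_le] at h3
  rw [Matrix.mul_smul, Matrix.smul_mul]
  exact (add_le_add_right (le_opNorm_smul_one (transpose_eq_of_nonneg hY)) _).trans h3

end Stability

/-! ### Second moments of the trajectory and the average cost -/

section Cost

variable {dx du : ℕ}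

instance (dx : ℕ) : IsProbabilityMeasure (noiseLaw dx) := by
  unfold noiseLaw; infer_instance

theorem measurePreserving_noise (s : ℕ) (i : Fin dx) :
    MeasurePreserving (fun w : ℕ → Fin dx → ℝ => w s i) (noiseLaw dx) (gaussianReal 0 1) :=
  (measurePreserving_eval (fun _ : Fin dx => gaussianReal 0 1) i).comp
    (measurePreserving_eval_infinitePi
      (fun _ : ℕ => Measure.pi fun _ : Fin dx => gaussianReal 0 1) s)

theorem memLp_noise (s : ℕ) (i : Fin dx) :
    MemLp (fun w : ℕ → Fin dx → ℝ => w s i) 2 (noiseLaw dx) :=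
  (memLp_id_gaussianReal 2).comp_measurePreserving (measurePreserving_noise s i)

theorem integral_noise (s : ℕ) (i : Fin dx) : ∫ w, w s i ∂noiseLaw dx = 0 := by
  have h := (measurePreserving_noise s i).map_eq
  have := integral_map (μ := noiseLaw dx) (φ := fun w : ℕ → Fin dx → ℝ => w s i) (f := id)
    (measurePreserving_noise s i).measurable.aemeasurable (by fun_prop)
  rw [h] at this
  simpa [integral_id_gaussianReal] using this.symm

theorem integral_noise_mul_self (s : ℕ) (i : Fin dx) :
    ∫ w, w s i * w s i ∂noiseLaw dx = 1 := by
  have h := (measurePreserving_noise s i).map_eq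
  have := integral_map (μ := noiseLaw dx) (φ := fun w : ℕ → Fin dx → ℝ => w s i)
    (f := fun x => x * x) (measurePreserving_noise s i).measurable.aemeasurable (by fun_prop)
  rw [h] at this
  rw [← this]
  have hv := variance_id_gaussianReal (μ := 0) (v := 1)
  rw [variance_of_integral_eq_zero (by fun_prop) (by simp)] at hv
  simpa [sq] using hv

/-- All scalar noises, indexed by time and coordinate together, are independent and centred with
unit variance. -/
theorem integral_noise_mul (s t : ℕ) (i j : Fin dx) :
    ∫ w, w s i * w t j ∂noiseLaw dx = if (s, i) = (t, j) then 1 else 0 := by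
  split_ifs with h
  · obtain ⟨rfl, rfl⟩ := Prod.mk.inj h
    exact integral_noise_mul_self s i
  · have hind : iIndepFun (fun (p : ℕ × Fin dx) (w : ℕ → Fin dx → ℝ) => w p.1 p.2)
        (noiseLaw dx) := by
      have := iIndepFun_uncurry_infinitePi' (X := fun (_ : ℕ) (_ : Fin dx) (x : ℝ) => x)
        (fun (_ : ℕ) (_ : Fin dx) => gaussianReal 0 1) (fun _ _ => measurable_id)
      simpa only [noiseLaw, Measure.infinitePi_eq_pi] using this
    have := (hind.indepFun h).integral_fun_mul_eq_mul_integral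
      (memLp_noise s i).aestronglyMeasurable (memLp_noise t j).aestronglyMeasurable
    simpa [integral_noise] using this

variable (A : Matrix (Fin dx) (Fin dx) ℝ) (B : Matrix (Fin dx) (Fin du) ℝ)
  (K : Matrix (Fin du) (Fin dx) ℝ)

theorem state_succ (w : ℕ → Fin dx → ℝ) (t : ℕ) :
    state A B K w (t + 1) = (A + B * K) *ᵥ state A B K w t + w t := by
  rw [state, Matrix.add_mulVec, Matrix.mulVec_mulVec]

theorem state_succ_apply (w : ℕ → Fin dx → ℝ) (t : ℕ) (i : Fin dx) :
    state A B K w (t + 1) i = ∑ k, (A + B * K) i k * state A B K w t k + w t i := by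
  rw [state_succ]; rfl

theorem memLp_state (t : ℕ) (i : Fin dx) :
    MemLp (fun w => state A B K w t i) 2 (noiseLaw dx) := by
  induction t generalizing i with
  | zero => exact MemLp.zero
  | succ t ih =>
    simp only [state_succ_apply]
    exact (memLp_finsetSum _ fun k _ => (ih k).const_mul _).add (memLp_noise t i)

theorem integrable_state_mul_noise (t s : ℕ) (i j : Fin dx) :
    Integrable (fun w => state A B K w t i * w s j) (noiseLaw dx) :=
  (memLp_state A B K t i).integrable_mul (memLp_noise s j)

theorem integrable_state_mul_state (t : ℕ) (i j : Fin dx) :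
    Integrable (fun w => state A B K w t i * state A B K w t j) (noiseLaw dx) :=
  (memLp_state A B K t i).integrable_mul (memLp_state A B K t j)

/-- The state at time `t` is linear in the noises before `t`, so induction on the recursion needs
only uncorrelated noise. -/
theorem integral_state_mul_noise (t s : ℕ) (hts : t ≤ s) (i j : Fin dx) :
    ∫ w, state A B K w t i * w s j ∂noiseLaw dx = 0 := by
  induction t generalizing i with
  | zero => simp [state]
  | succ t ih =>
    have hne : (t, i) ≠ (s, j) := fun h => by have := (Prod.mk.inj h).1; omega
    have hint : ∀ (c : Fin dx → ℝ), ∀ k ∈ Finset.univ, Integrable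
        (fun w => c k * (state A B K w t k * w s j)) (noiseLaw dx) := fun c k _ =>
      (integrable_state_mul_noise A B K t s k j).const_mul _
    have hsum : ∀ c : Fin dx → ℝ,
        ∫ w, (∑ k, c k * (state A B K w t k * w s j) + w t i * w s j) ∂noiseLaw dx = 0 := by
      intro c
      refine (integral_add (integrable_finsetSum _ (hint c))
        ((memLp_noise t i).integrable_mul (memLp_noise s j))).trans ?_
      rw [integral_finsetSum _ (hint c)]
      have h0 : ∫ w, ((fun w : ℕ → Fin dx → ℝ => w t i) *
          fun w : ℕ → Fin dx → ℝ => w s j) w ∂noiseLaw dx = 0 :=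
        (integral_noise_mul t s i j).trans (if_neg hne)
      rw [h0]
      simp [integral_const_mul, ih (by omega)]
    simp only [state_succ_apply, add_mul, Finset.sum_mul, mul_assoc]
    exact hsum fun k => (A + B * K) i k

theorem dotProduct_mulVec_eq_sum (Q : Matrix (Fin dx) (Fin dx) ℝ) (x y : Fin dx → ℝ) :
    x ⬝ᵥ Q *ᵥ y = ∑ i, ∑ j, Q i j * (x i * y j) := by
  simp only [dotProduct, Matrix.mulVec, Finset.mul_sum]
  exact Finset.sum_congr rfl fun i _ => Finset.sum_congr rfl fun j _ => by ring

theorem integrable_dotProduct_mulVec {Ω : Type*} [MeasurableSpace Ω] {μ : Measure Ω}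
    {f g : Ω → Fin dx → ℝ} (h : ∀ i j, Integrable (fun w => f w i * g w j) μ)
    (Q : Matrix (Fin dx) (Fin dx) ℝ) : Integrable (fun w => f w ⬝ᵥ Q *ᵥ g w) μ := by
  simp only [dotProduct_mulVec_eq_sum]
  exact integrable_finsetSum _ fun i _ => integrable_finsetSum _ fun j _ => (h i j).const_mul _

theorem integral_dotProduct_mulVec {Ω : Type*} [MeasurableSpace Ω] {μ : Measure Ω}
    {f g : Ω → Fin dx → ℝ} (h : ∀ i j, Integrable (fun w => f w i * g w j) μ)
    (Q : Matrix (Fin dx) (Fin dx) ℝ) :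
    ∫ w, f w ⬝ᵥ Q *ᵥ g w ∂μ = ∑ i, ∑ j, Q i j * ∫ w, f w i * g w j ∂μ := by
  have key : ∀ c : Fin dx → Fin dx → ℝ, ∫ w, ∑ i, ∑ j, c i j * (f w i * g w j) ∂μ =
      ∑ i, ∑ j, c i j * ∫ w, f w i * g w j ∂μ := by
    intro c
    rw [integral_finsetSum _ fun i _ => integrable_finsetSum _ fun j _ => (h i j).const_mul _]
    refine Finset.sum_congr rfl fun i _ => ?_
    rw [integral_finsetSum _ fun j _ => (h i j).const_mul _]
    simp only [integral_const_mul]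
  simp only [dotProduct_mulVec_eq_sum]
  exact key fun i j => Q i j

theorem integrable_quadratic_state (Q : Matrix (Fin dx) (Fin dx) ℝ) (t : ℕ) :
    Integrable (fun w => state A B K w t ⬝ᵥ Q *ᵥ state A B K w t) (noiseLaw dx) :=
  integrable_dotProduct_mulVec (integrable_state_mul_state A B K t) Q

theorem integral_quadratic_state_succ (Q : Matrix (Fin dx) (Fin dx) ℝ) (t : ℕ) :
    ∫ w, state A B K w (t + 1) ⬝ᵥ Q *ᵥ state A B K w (t + 1) ∂noiseLaw dx =
      ∫ w, state A B K w t ⬝ᵥ ((A + B * K)ᵀ * Q * (A + B * K)) *ᵥ state A B K w t ∂noiseLaw dx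
        + Q.trace := by
  have hexp : ∀ w : ℕ → Fin dx → ℝ, state A B K w (t + 1) ⬝ᵥ Q *ᵥ state A B K w (t + 1) =
      state A B K w t ⬝ᵥ ((A + B * K)ᵀ * Q * (A + B * K)) *ᵥ state A B K w t
        + state A B K w t ⬝ᵥ ((A + B * K)ᵀ * Q + (Q * (A + B * K))ᵀ) *ᵥ w t
        + w t ⬝ᵥ Q *ᵥ w t := by
    intro w
    rw [state_succ]
    generalize A + B * K = L
    have h1 : w t ⬝ᵥ Q *ᵥ (L *ᵥ state A B K w t) = state A B K w t ⬝ᵥ (Q * L)ᵀ *ᵥ w t := by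
      rw [Matrix.mulVec_mulVec, Matrix.mulVec_transpose, dotProduct_comm (state A B K w t),
        Matrix.dotProduct_mulVec]
    have h2 : ∀ v, (L *ᵥ state A B K w t) ⬝ᵥ v = state A B K w t ⬝ᵥ Lᵀ *ᵥ v := by
      intro v
      rw [Matrix.dotProduct_mulVec, Matrix.vecMul_transpose]
    rw [Matrix.mulVec_add, add_dotProduct, dotProduct_add, dotProduct_add, h1, h2,
      h2, Matrix.add_mulVec, dotProduct_add]
    simp only [Matrix.mulVec_mulVec, Matrix.mul_assoc]
    ring
  have hnn : ∀ i j, Integrable (fun w : ℕ → Fin dx → ℝ => w t i * w t j) (noiseLaw dx) :=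
    fun i j => (memLp_noise t i).integrable_mul (memLp_noise t j)
  have hsn := integrable_state_mul_noise A B K t t
  simp only [hexp]
  refine (integral_add ((integrable_quadratic_state A B K _ t).add
    (integrable_dotProduct_mulVec hsn _)) (integrable_dotProduct_mulVec hnn Q)).trans ?_
  refine congrArg₂ (· + ·) ((integral_add (integrable_quadratic_state A B K _ t)
    (integrable_dotProduct_mulVec hsn _)).trans (add_eq_left.2 ?_)) ?_
  · rw [integral_dotProduct_mulVec hsn]
    simp [integral_state_mul_noise]
  · rw [integral_dotProduct_mulVec hnn]
    simp [integral_noise_mul, Matrix.trace]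

/-- Peels the recursion at its inner end, matching the way one step of the dynamics pulls a
quadratic form back. -/
theorem lyapunovIter_add_conj (X Y : Matrix (Fin dx) (Fin dx) ℝ) (t : ℕ) :
    lyapunovIter X Y (t + 1) = Y + lyapunovIter X (Xᵀ * Y * X) t := by
  induction t with
  | zero => simp [lyapunovIter]
  | succ t ih =>
    rw [lyapunovIter, ih, lyapunovIter]
    simp only [Matrix.mul_add, Matrix.add_mul]
    abel

theorem integral_quadratic_state (Q : Matrix (Fin dx) (Fin dx) ℝ) (t : ℕ) :
    ∫ w, state A B K w t ⬝ᵥ Q *ᵥ state A B K w t ∂noiseLaw dx =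
      (lyapunovIter (A + B * K) Q t).trace := by
  -- The form changes to $(A+BK)^\top Q (A+BK)$ at each step, hence the generalization over `Q`.
  induction t generalizing Q with
  | zero => simp [state, lyapunovIter]
  | succ t ih =>
    rw [integral_quadratic_state_succ, ih, lyapunovIter_add_conj, Matrix.trace_add, add_comm]

theorem stageCost_eq (Rx : Matrix (Fin dx) (Fin dx) ℝ) (x : Fin dx → ℝ) :
    stageCost Rx 1 x (K *ᵥ x) = x ⬝ᵥ (Rx + Kᵀ * K) *ᵥ x := by
  rw [stageCost, Matrix.one_mulVec, Matrix.add_mulVec, dotProduct_add,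
    dotProduct_transpose_mul_self]

theorem integral_sum_stageCost (Rx : Matrix (Fin dx) (Fin dx) ℝ) (T : ℕ) :
    ∫ w, ∑ t ∈ Finset.range T,
      stageCost Rx 1 (state A B K w t) (K *ᵥ state A B K w t) ∂(noiseLaw dx) =
    ∑ t ∈ Finset.range T, (lyapunovIter (A + B * K) (Rx + Kᵀ * K) t).trace := by
  simp only [stageCost_eq]
  rw [integral_finsetSum _ fun t _ => integrable_quadratic_state A B K _ t]
  simp only [integral_quadratic_state]

variable {A B K}

/-- The expected stage costs converge to the trace of `P`, hence so do their Cesàro means. -/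
theorem hasAverageCost_of_tendsto {Rx P : Matrix (Fin dx) (Fin dx) ℝ}
    (h : Tendsto (lyapunovIter (A + B * K) (Rx + Kᵀ * K)) atTop (𝓝 P)) :
    HasAverageCost Rx 1 A B K P.trace := by
  have hc : Continuous fun M : Matrix (Fin dx) (Fin dx) ℝ => M.trace :=
    continuous_id.matrix_trace
  have := ((hc.tendsto P).comp h).cesaro
  simpa only [HasAverageCost, integral_sum_stageCost, one_div, Function.comp_apply] using this

/-- No controller has a smaller average cost than the limit of value iteration. -/
theorem trace_le_of_hasAverageCost {Rx P : Matrix (Fin dx) (Fin dx) ℝ} (hR : 0 ≤ Rx)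
    (h : Tendsto (riccatiIter Rx A B) atTop (𝓝 P)) {J : ℝ} (hJ : HasAverageCost Rx 1 A B K J) :
    P.trace ≤ J := by
  have hc : Continuous fun M : Matrix (Fin dx) (Fin dx) ℝ => M.trace :=
    continuous_id.matrix_trace
  refine le_of_tendsto_of_tendsto' ((hc.tendsto P).comp h).cesaro hJ fun T => ?_
  rw [integral_sum_stageCost, one_div]
  exact mul_le_mul_of_nonneg_left (Finset.sum_le_sum fun t _ =>
    trace_mono (riccatiIter_le_lyapunovIter hR A B K t)) (by positivity)

end Cost

/-! ### Perturbation of Riccati solutions and optimal controllers -/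

section Perturbation

variable {dx du : ℕ} {Rx A A' P P' : Matrix (Fin dx) (Fin dx) ℝ}
  {B B' : Matrix (Fin dx) (Fin du) ℝ}

theorem IsDARESolution.eq_mul_closedLoop (h : IsDARESolution Rx 1 A B P) :
    P = Aᵀ * P * (A + B * gain A B P) + Rx := by
  conv_lhs => rw [← (isDARESolution_iff.1 h).2]
  simp only [riccatiMap, gain, Matrix.mul_neg, Matrix.mul_add, Matrix.mul_assoc, sub_eq_add_neg]

theorem IsDARESolution.one_le (h : IsDARESolution Rx 1 A B P) (hR : 1 ≤ Rx) : 1 ≤ P := by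
  rw [← h.policyMap_gain]
  exact le_add_of_nonneg_of_le (transpose_mul_mul_nonneg h.nonneg _)
    (le_add_of_le_of_nonneg hR (transpose_mul_self_nonneg _))

/-- The exact difference of the solutions of two Riccati equations. -/
theorem IsDARESolution.sub_eq (hR : 0 ≤ Rx) (h : IsDARESolution Rx 1 A B P)
    (h' : IsDARESolution Rx 1 A' B' P') :
    P' - P = (A + B * gain A B P)ᵀ * (P' - P) * (A' + B' * gain A' B' P')
      + (A' - A + (B' - B) * gain A B P)ᵀ * P' * (A' + B' * gain A' B' P')
      + (A + B * gain A B P)ᵀ * P * (A' - A + (B' - B) * gain A' B' P') := by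
  have hRt := transpose_eq_of_nonneg hR
  have hPt := transpose_eq_of_nonneg h.nonneg
  have e1 := congrArg Matrix.transpose h.eq_mul_closedLoop
  have e2 := h'.eq_mul_closedLoop
  have g1 := congrArg Matrix.transpose (gain_add_eq_zero h.nonneg A B)
  have g2 := gain_add_eq_zero h'.nonneg A' B'
  generalize gain A B P = K at *
  generalize gain A' B' P' = K' at *
  generalize hL : A + B * K = L at *
  generalize hL' : A' + B' * K' = L' at *
  simp only [Matrix.transpose_add, Matrix.transpose_mul, Matrix.transpose_transpose, hPt, hRt,
    Matrix.transpose_zero] at e1 g1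
  have t1 : Lᵀ * (P' * L') = Aᵀ * (P' * L') + Kᵀ * (Bᵀ * (P' * L')) := by
    rw [← hL]
    simp only [Matrix.transpose_add, Matrix.transpose_mul, Matrix.add_mul, Matrix.mul_assoc]
  have t2 : Lᵀ * P * L' = Lᵀ * P * A' + Lᵀ * P * B' * K' := by
    rw [← hL', Matrix.mul_add, ← Matrix.mul_assoc _ B']
  have g1' : Lᵀ * P * B = -Kᵀ := by
    rw [Matrix.mul_assoc]; exact eq_neg_of_add_eq_zero_right g1
  have g2' : B'ᵀ * (P' * L') = -K' := by
    rw [← Matrix.mul_assoc]; exact eq_neg_of_add_eq_zero_right g2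
  have e1' : P = Lᵀ * P * A + Rx := by rw [Matrix.mul_assoc]; exact e1
  have e2' : P' = A'ᵀ * (P' * L') + Rx := by rw [← Matrix.mul_assoc]; exact e2
  have key : Lᵀ * (P' - P) * L' + (A' - A + (B' - B) * K)ᵀ * P' * L'
      + Lᵀ * P * (A' - A + (B' - B) * K') =
      A'ᵀ * (P' * L') + Kᵀ * (B'ᵀ * (P' * L')) - Lᵀ * P * A - Lᵀ * P * B * K' := by
    rw [Matrix.mul_sub, Matrix.sub_mul, t2, Matrix.mul_assoc Lᵀ P', t1]
    simp only [Matrix.transpose_add, Matrix.transpose_sub, Matrix.transpose_mul, Matrix.add_mul,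
      Matrix.sub_mul, Matrix.mul_add, Matrix.mul_sub, Matrix.mul_assoc]
    abel
  -- The optimality conditions turn both mixed terms into $K^\top K'$ with opposite signs, leaving
  -- $A'^\top P' L' - L^\top P A = P' - P$.
  rw [key, g1', g2']
  nth_rewrite 1 [e1', e2']
  simp only [Matrix.mul_neg, Matrix.neg_mul]
  abel

/-- The exact difference of two optimal controllers. -/
theorem IsDARESolution.gain_sub_eq (h : IsDARESolution Rx 1 A B P)
    (h' : IsDARESolution Rx 1 A' B' P') :
    (1 + Bᵀ * P * B) * (gain A' B' P' - gain A B P) =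
      -((B' - B)ᵀ * P' * (A' + B' * gain A' B' P')
        + Bᵀ * (P' - P) * (A' + B' * gain A' B' P')
        + Bᵀ * P * (A' - A + (B' - B) * gain A' B' P')) := by
  have g1 := one_add_mul_gain h.nonneg A B
  have g2 := gain_add_eq_zero h'.nonneg A' B'
  rw [Matrix.mul_sub, g1]
  generalize gain A B P = K at *
  generalize gain A' B' P' = K' at *
  have g2' := eq_neg_of_add_eq_zero_left g2
  rw [Matrix.add_mul, Matrix.one_mul]
  nth_rewrite 1 [g2']
  simp only [Matrix.transpose_sub, Matrix.sub_mul, Matrix.mul_add, Matrix.mul_sub, Matrix.mul_assoc]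
  abel

/-- Norm bounds for an optimal closed loop in terms of a square root of the value matrix. -/
theorem IsDARESolution.exists_root (hR : 1 ≤ Rx) (h : IsDARESolution Rx 1 A B P) {s : ℝ}
    (hs : 1 ≤ s) (hP : opNorm P ≤ s ^ 2) :
    ∃ S : Matrix (Fin dx) (Fin dx) ℝ, P = Sᵀ * S ∧ IsUnit S.det ∧ opNorm S ≤ s ∧
      opNorm S⁻¹ ≤ 1 ∧ opNorm (S * (A + B * gain A B P)) ≤ s ∧
      opNorm (gain A B P * S⁻¹) ≤ 1 ∧ opNorm (gain A B P) ≤ s ∧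
      opNorm (S * (A + B * gain A B P) * S⁻¹) ≤ √(1 - 1 / s ^ 2) := by
  have h1 := h.one_le hR
  have hpm := h.policyMap_gain
  have hR0 := zero_le_one_matrix.trans hR
  obtain ⟨S, hS⟩ := exists_eq_transpose_mul_self h.nonneg
  have hs0 : 0 ≤ s := by linarith
  generalize gain A B P = K at *
  have hK : Kᵀ * K ≤ P := by
    rw [← hpm]
    exact le_add_of_nonneg_of_le (transpose_mul_mul_nonneg h.nonneg _)
      (le_add_of_nonneg_left hR0)
  have hL : (S * (A + B * K))ᵀ * (S * (A + B * K)) ≤ P := by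
    have : (S * (A + B * K))ᵀ * (S * (A + B * K)) = (A + B * K)ᵀ * P * (A + B * K) := by
      rw [hS, Matrix.transpose_mul]; simp only [Matrix.mul_assoc]
    rw [this]
    conv_rhs => rw [← hpm]
    exact le_add_of_nonneg_right (add_nonneg hR0 (transpose_mul_self_nonneg _))
  have hle : ∀ {m : ℕ} {X : Matrix (Fin m) (Fin dx) ℝ}, Xᵀ * X ≤ P → opNorm X ≤ s := by
    intro m X hX
    exact (sq_le_sq₀ (opNorm_nonneg _) hs0).1 ((opNorm_sq_le hX).trans hP)
  have h1S : 1 ≤ Sᵀ * S := hS ▸ h1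
  have hdet := isUnit_det_of_one_le h1S
  have hSs := hle hS.symm.le
  refine ⟨S, hS, hdet, hSs, opNorm_inv_le_one h1S, hle hL, ?_, hle hK, ?_⟩
  · refine opNorm_mul_inv_le zero_le_one hdet ?_
    rwa [one_pow, one_smul, ← hS]
  · refine opNorm_conj_le (Y := Rx + Kᵀ * K) (one_le_pow₀ hs)
      (pow_le_pow_left₀ (opNorm_nonneg _) hSs 2) h1S
      (le_add_of_le_of_nonneg hR (transpose_mul_self_nonneg _)) ?_
    rw [← hS]
    exact hpm.le

/-- Perturbation bounds for the value matrix and the optimal controller, in any norm that is an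
operator ideal norm. -/
theorem IsOperatorIdealNorm.perturbation
    {N : ∀ {a b : ℕ}, Matrix (Fin a) (Fin b) ℝ → ℝ} (hN : IsOperatorIdealNorm N)
    (hR : 1 ≤ Rx) (h : IsDARESolution Rx 1 A B P) (h' : IsDARESolution Rx 1 A' B' P')
    {s ε : ℝ} (hs : 1 ≤ s) (hP : opNorm P ≤ s ^ 2) (hP' : opNorm P' ≤ s ^ 2)
    (hA : N (A' - A) ≤ ε) (hB : N (B' - B) ≤ ε) :
    N (P' - P) ≤ 4 * s ^ 5 * ε ∧
      ∀ T : Matrix (Fin du) (Fin du) ℝ, Tᵀ * T = 1 + Bᵀ * P * B →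
        N (T * (gain A' B' P' - gain A B P)) ≤ 7 * s ^ 4 * ε := by
  have hs0 : 0 < s := by linarith
  have hε : 0 ≤ ε := (hN.nonneg _).trans hA
  have hsub := IsDARESolution.sub_eq (zero_le_one_matrix.trans hR) h h'
  have hgain := h.gain_sub_eq h'
  obtain ⟨S, hS, hSd, hSn, hSi, hSL, hKS, hKn, hc⟩ := h.exists_root hR hs hP
  obtain ⟨S', hS', hSd', hSn', hSi', hSL', hKS', hKn', hc'⟩ := h'.exists_root hR hs hP'
  generalize gain A B P = K at *
  generalize gain A' B' P' = K' at *
  generalize hL : A + B * K = L at *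
  generalize hL' : A' + B' * K' = L' at *
  generalize hE : A' - A + (B' - B) * K = E at *
  generalize hE' : A' - A + (B' - B) * K' = E' at *
  have hop : ∀ {a b c : ℕ} (X : Matrix (Fin a) (Fin b) ℝ) (Y : Matrix (Fin b) (Fin c) ℝ) {x y : ℝ},
      opNorm X ≤ x → N Y ≤ y → N (X * Y) ≤ x * y := fun X Y x y hx hy =>
    (hN.mul_le_opNorm_mul X Y).trans (mul_le_mul hx hy (hN.nonneg _) ((opNorm_nonneg _).trans hx))
  have hpo : ∀ {a b c : ℕ} (X : Matrix (Fin a) (Fin b) ℝ) (Y : Matrix (Fin b) (Fin c) ℝ) {x y : ℝ},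
      N X ≤ x → opNorm Y ≤ y → N (X * Y) ≤ x * y := fun X Y x y hx hy =>
    (hN.mul_le_mul_opNorm X Y).trans (mul_le_mul hx hy (opNorm_nonneg _) ((hN.nonneg _).trans hx))
  -- Using $\|K'S'^{-1}\| \le 1$ instead of $\|K'\| \le s$ saves a factor $s$.
  have hES' : N (E' * S'⁻¹) ≤ 2 * ε := by
    rw [← hE', Matrix.add_mul, Matrix.mul_assoc]
    have := hN.add_le ((A' - A) * S'⁻¹) ((B' - B) * (K' * S'⁻¹))
    have h1 := hpo _ _ hA hSi'
    have h2 := hpo _ _ hB hKS'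
    linarith
  have hES : N (E * S⁻¹) ≤ 2 * ε := by
    rw [← hE, Matrix.add_mul, Matrix.mul_assoc]
    have := hN.add_le ((A' - A) * S⁻¹) ((B' - B) * (K * S⁻¹))
    have h1 := hpo _ _ hA hSi
    have h2 := hpo _ _ hB hKS
    linarith
  have hEn : N E' ≤ 2 * s * ε := by
    rw [← hE']
    have := hN.add_le (A' - A) ((B' - B) * K')
    have h2 := hpo _ _ hB hKn'
    nlinarith
  -- The recursion has $L$ on the left and $L'$ on the right, so each side is normalized by its own
  -- root.
  set D := S⁻¹ᵀ * (P' - P) * S'⁻¹ with hD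
  have hΔ : P' - P = Sᵀ * D * S' := by
    have hl : Sᵀ * S⁻¹ᵀ = 1 := by
      rw [← Matrix.transpose_mul, Matrix.nonsing_inv_mul _ hSd, Matrix.transpose_one]
    rw [hD, Matrix.mul_assoc Sᵀ, Matrix.mul_assoc,
      Matrix.nonsing_inv_mul _ hSd', Matrix.mul_one, ← Matrix.mul_assoc, hl, Matrix.one_mul]
  have hDeq : D = (S * L * S⁻¹)ᵀ * (D * (S' * L' * S'⁻¹)) +
      (E * S⁻¹)ᵀ * (S'ᵀ * (S' * L' * S'⁻¹)) + (S * L * S⁻¹)ᵀ * (S * (E' * S'⁻¹)) := by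
    conv_lhs => rw [hD, hsub, hΔ, hS', hS]
    simp only [Matrix.transpose_mul, Matrix.mul_add, Matrix.add_mul, Matrix.mul_assoc]
  have hq : 1 - 1 / s ^ 2 ≥ 0 := by
    rw [ge_iff_le, sub_nonneg, div_le_one (by positivity)]; exact one_le_pow₀ hs
  have hr1 : √(1 - 1 / s ^ 2) ≤ 1 := by
    refine Real.sqrt_le_iff.2 ⟨zero_le_one, ?_⟩
    linarith [show 0 ≤ 1 / s ^ 2 by positivity]
  have hrr : √(1 - 1 / s ^ 2) * √(1 - 1 / s ^ 2) = 1 - 1 / s ^ 2 := Real.mul_self_sqrt hq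
  have hDn : N D ≤ 4 * s ^ 3 * ε := by
    have hct : opNorm (S * L * S⁻¹)ᵀ ≤ √(1 - 1 / s ^ 2) := by rwa [opNorm_transpose]
    have hSt : opNorm S'ᵀ ≤ s := by rwa [opNorm_transpose]
    have n1 := hop _ _ hct (hpo D _ le_rfl hc')
    have hx : opNorm (S'ᵀ * (S' * L' * S'⁻¹)) ≤ s * 1 :=
      (opNorm_mul_le _ _).trans (mul_le_mul hSt (hc'.trans hr1) (opNorm_nonneg _) hs0.le)
    have n2 := hpo (E * S⁻¹)ᵀ _ ((hN.transpose _).trans_le hES) hx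
    have n3 := hop _ _ (hct.trans hr1) (hop S _ hSn hES')
    have n4 := hN.add_le ((S * L * S⁻¹)ᵀ * (D * (S' * L' * S'⁻¹)) +
      (E * S⁻¹)ᵀ * (S'ᵀ * (S' * L' * S'⁻¹))) ((S * L * S⁻¹)ᵀ * (S * (E' * S'⁻¹)))
    have n5 := hN.add_le ((S * L * S⁻¹)ᵀ * (D * (S' * L' * S'⁻¹)))
      ((E * S⁻¹)ᵀ * (S'ᵀ * (S' * L' * S'⁻¹)))
    rw [← hDeq] at n4
    -- The two contraction factors multiply to $1 - 1/s^2$, so solving for `N D` costs a factor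
    -- $s^2$.
    have n6 : N D ≤ (1 - 1 / s ^ 2) * N D + 4 * s * ε := by
      rw [← hrr]; linarith
    have n7 : N D / s ^ 2 ≤ 4 * s * ε := by
      have : (1 - 1 / s ^ 2) * N D = N D - N D / s ^ 2 := by ring
      linarith
    rw [div_le_iff₀ (by positivity)] at n7
    linarith
  refine ⟨?_, fun T hT => ?_⟩
  · rw [hΔ]
    have := hpo _ _ (hop Sᵀ D ((opNorm_transpose S).trans_le hSn) hDn) hSn'
    linarith
  · have hR1 : 1 ≤ Tᵀ * T := by
      rw [hT]; exact le_add_of_nonneg_right (transpose_mul_mul_nonneg h.nonneg B)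
    have hTd := isUnit_det_of_one_le hR1
    have hTi : opNorm T⁻¹ᵀ ≤ 1 := (opNorm_transpose _).trans_le (opNorm_inv_le_one hR1)
    have hSB : opNorm (S * B * T⁻¹)ᵀ ≤ 1 := by
      rw [opNorm_transpose]
      refine opNorm_mul_inv_le zero_le_one hTd ?_
      rw [hT, one_pow, one_smul, hS, Matrix.transpose_mul, Matrix.mul_assoc, ← Matrix.mul_assoc Sᵀ,
        ← Matrix.mul_assoc]
      exact le_add_of_nonneg_left zero_le_one_matrix
    have hTeq : T * (K' - K) = -(T⁻¹ᵀ * ((B' - B)ᵀ * (S'ᵀ * (S' * L'))) +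
        (S * B * T⁻¹)ᵀ * (D * (S' * L')) + (S * B * T⁻¹)ᵀ * (S * E')) := by
      have hl : T⁻¹ᵀ * Tᵀ = 1 := by
        rw [← Matrix.transpose_mul, Matrix.mul_nonsing_inv _ hTd, Matrix.transpose_one]
      have : T * (K' - K) = T⁻¹ᵀ * (Tᵀ * T * (K' - K)) := by
        rw [Matrix.mul_assoc Tᵀ, ← Matrix.mul_assoc T⁻¹ᵀ, hl, Matrix.one_mul]
      rw [this, hT, hgain, hΔ, hS', hS]
      simp only [Matrix.transpose_mul, Matrix.mul_add, Matrix.mul_neg, Matrix.mul_assoc]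
    have hx : opNorm (S'ᵀ * (S' * L')) ≤ s * s :=
      (opNorm_mul_le _ _).trans (mul_le_mul ((opNorm_transpose S').trans_le hSn') hSL'
        (opNorm_nonneg _) hs0.le)
    have n1 := hop _ _ hTi (hpo (B' - B)ᵀ _ ((hN.transpose _).trans_le hB) hx)
    have n2 := hop _ _ hSB (hpo D _ hDn hSL')
    have n3 := hop _ _ hSB (hop S E' hSn hEn)
    have n4 := hN.add_le (T⁻¹ᵀ * ((B' - B)ᵀ * (S'ᵀ * (S' * L'))) +
      (S * B * T⁻¹)ᵀ * (D * (S' * L'))) ((S * B * T⁻¹)ᵀ * (S * E'))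
    have n5 := hN.add_le (T⁻¹ᵀ * ((B' - B)ᵀ * (S'ᵀ * (S' * L')))) ((S * B * T⁻¹)ᵀ * (D * (S' * L')))
    rw [hTeq, hN.neg]
    -- The three terms contribute $s^2 + 4s^4 + 2s^2 \le 7s^4$.
    have hs2 : s ^ 2 * ε ≤ s ^ 4 * ε :=
      mul_le_mul_of_nonneg_right (pow_le_pow_right₀ hs (by norm_num)) hε
    nlinarith

/-- The perturbation bound with equal systems, `ε = 0`, and `s` large enough for both solutions. -/
theorem IsDARESolution.unique (hR : 1 ≤ Rx) (h : IsDARESolution Rx 1 A B P)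
    (h' : IsDARESolution Rx 1 A B P') : P = P' := by
  set s := max 1 (max (opNorm P) (opNorm P')) with hs
  have hs1 : 1 ≤ s := le_max_left _ _
  have hs2 : s ≤ s ^ 2 := le_self_pow₀ hs1 (by norm_num)
  have h0 : ∀ {b : ℕ} (X : Matrix (Fin dx) (Fin b) ℝ), opNorm (X - X) ≤ 0 := fun X => by
    rw [sub_self, (opNorm_eq_zero_iff _).2 rfl]
  have h1 := (isOperatorIdealNorm_opNorm.perturbation hR h h' hs1
    (((le_max_left _ _).trans (le_max_right _ _)).trans hs2)
    (((le_max_right _ _).trans (le_max_right _ _)).trans hs2) (h0 A) (h0 B)).1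
  rw [mul_zero] at h1
  exact (sub_eq_zero.1 ((opNorm_eq_zero_iff _).1 (h1.antisymm (opNorm_nonneg _)))).symm

theorem IsLyapunovSolution.unique {X Y : Matrix (Fin dx) (Fin dx) ℝ} (hY : 1 ≤ Y)
    (h : IsLyapunovSolution X Y P) (h' : IsLyapunovSolution X Y P') : P = P' :=
  IsDARESolution.unique hY (isLyapunovSolution_iff_isDARESolution.1 h)
    (isLyapunovSolution_iff_isDARESolution.1 h')

/-- The value matrix of the optimal controller, slightly inflated, is a supersolution for a nearby
system. -/
theorem IsDARESolution.policyMap_smul_le (hR : 1 ≤ Rx) (h : IsDARESolution Rx 1 A B P)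
    {p ε δ : ℝ} (hp : 1 ≤ p) (hP : opNorm P ≤ p) (hA : opNorm (A' - A) ≤ ε)
    (hB : opNorm (B' - B) ≤ ε) (hδ : 4 * p ^ 2 * ε + 4 * p ^ 2 * ε ^ 2 ≤ δ) (hδ1 : δ < 1) :
    policyMap Rx A' B' (gain A B P) ((1 - δ)⁻¹ • P) ≤ (1 - δ)⁻¹ • P := by
  have hε : 0 ≤ ε := (opNorm_nonneg _).trans hA
  have hss : √p ^ 2 = p := Real.sq_sqrt (by linarith)
  have hs : 1 ≤ √p := Real.one_le_sqrt.2 hp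
  obtain ⟨S, hS, -, hSn, -, hSL, -, hKn, -⟩ := h.exists_root hR hs (by rwa [hss])
  have hpm := h.policyMap_gain
  have hPt := transpose_eq_of_nonneg h.nonneg
  generalize √p = s at *
  generalize gain A B P = K at *
  rw [policyMap] at hpm ⊢
  have hY1 : 1 ≤ Rx + Kᵀ * K := le_add_of_le_of_nonneg hR (transpose_mul_self_nonneg K)
  generalize Rx + Kᵀ * K = Y at *
  have hL' : A' + B' * K = (A + B * K) + (A' - A + (B' - B) * K) := by
    rw [Matrix.sub_mul]; abel
  have hEn : opNorm (A' - A + (B' - B) * K) ≤ 2 * s * ε := by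
    have h1 := opNorm_add_le (A' - A) ((B' - B) * K)
    have h2 : opNorm ((B' - B) * K) ≤ ε * s :=
      (opNorm_mul_le _ _).trans (mul_le_mul hB hKn (opNorm_nonneg _) hε)
    nlinarith
  rw [hL']
  generalize A + B * K = L at *
  generalize A' - A + (B' - B) * K = E at *
  -- `H` collects the change of $L^\top P L$ when $L$ becomes $L + E$. As $Y \succeq I$, a bound
  -- $\|H\| \le \delta$ lets $\delta Y$ absorb it, and dividing by $1 - \delta$ restores the full
  -- cost $Y$.
  set H := Lᵀ * P * E + Eᵀ * P * L + Eᵀ * P * E with hH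
  have hHt : Hᵀ = H := by
    simp only [hH, Matrix.transpose_add, Matrix.transpose_mul, Matrix.transpose_transpose, hPt,
      Matrix.mul_assoc]
    abel
  have hSE : opNorm (S * E) ≤ s * (2 * s * ε) :=
    (opNorm_mul_le _ _).trans (mul_le_mul hSn hEn (opNorm_nonneg _) (by linarith))
  have hprod : ∀ {X Z : Matrix (Fin dx) (Fin dx) ℝ} {x z : ℝ}, opNorm (S * X) ≤ x →
      opNorm (S * Z) ≤ z → opNorm (Xᵀ * P * Z) ≤ x * z := by
    intro X Z x z hx hz
    have : Xᵀ * P * Z = (S * X)ᵀ * (S * Z) := by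
      rw [hS, Matrix.transpose_mul]; simp only [Matrix.mul_assoc]
    rw [this]
    refine (opNorm_mul_le _ _).trans ?_
    rw [opNorm_transpose]
    exact mul_le_mul hx hz (opNorm_nonneg _) ((opNorm_nonneg _).trans hx)
  have hHn : opNorm H ≤ δ := by
    have h1 := opNorm_add_le (Lᵀ * P * E + Eᵀ * P * L) (Eᵀ * P * E)
    have h2 := opNorm_add_le (Lᵀ * P * E) (Eᵀ * P * L)
    have h3 := hprod hSL hSE
    have h4 := hprod hSE hSL
    have h5 := hprod hSE hSE
    have h6 : s * (s * (2 * s * ε)) ≤ 2 * p ^ 2 * ε := by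
      rw [← hss]
      have : s ^ 3 * ε ≤ s ^ 4 * ε :=
        mul_le_mul_of_nonneg_right (pow_le_pow_right₀ hs (by norm_num)) hε
      nlinarith
    have h7 : s * (2 * s * ε) * (s * (2 * s * ε)) = 4 * p ^ 2 * ε ^ 2 := by rw [← hss]; ring
    linarith
  have hHle : H ≤ δ • Y :=
    ((le_opNorm_smul_one hHt).trans (smul_le_smul_right hHn zero_le_one_matrix)).trans
      (smul_le_smul_left ((opNorm_nonneg _).trans hHn) hY1)
  have hexp : (L + E)ᵀ * P * (L + E) = Lᵀ * P * L + H := by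
    simp only [hH, Matrix.transpose_add, Matrix.add_mul, Matrix.mul_add]; abel
  have hmain : (L + E)ᵀ * P * (L + E) + (1 - δ) • Y ≤ P := by
    rw [hexp, sub_smul, one_smul]
    calc Lᵀ * P * L + H + (Y - δ • Y) ≤ Lᵀ * P * L + δ • Y + (Y - δ • Y) := by gcongr
      _ = Lᵀ * P * L + Y := by abel
      _ = P := hpm
  have h1δ : 0 < 1 - δ := by linarith
  have := smul_le_smul_left (inv_nonneg.2 h1δ.le) hmain
  rwa [smul_add, smul_smul, inv_mul_cancel₀ h1δ.ne', one_smul, ← Matrix.smul_mul,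
    ← Matrix.mul_smul] at this

/-- Norm bound for a Lyapunov recursion `ZᵀZ = (Z X)ᵀ (Z X) + Gᵀ G` in terms of a dominating
Lyapunov solution. -/
theorem IsOperatorIdealNorm.sq_le_of_lyapunov
    {N : ∀ {a b : ℕ}, Matrix (Fin a) (Fin b) ℝ → ℝ} (hN : IsOperatorIdealNorm N)
    (hsq : ∀ {a b c : ℕ} (Z : Matrix (Fin a) (Fin a) ℝ) (W : Matrix (Fin b) (Fin a) ℝ)
      (G : Matrix (Fin c) (Fin a) ℝ), Zᵀ * Z = Wᵀ * W + Gᵀ * G → N Z ^ 2 ≤ N W ^ 2 + N G ^ 2)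
    {X Y Z : Matrix (Fin dx) (Fin dx) ℝ} {G : Matrix (Fin du) (Fin dx) ℝ} (hY : 1 ≤ Y)
    (hP : IsLyapunovSolution X Y P) {p : ℝ} (hp : 1 ≤ p) (hPp : opNorm P ≤ p)
    (hZ : Zᵀ * Z = (Z * X)ᵀ * (Z * X) + Gᵀ * G) : N Z ^ 2 ≤ p ^ 2 * N G ^ 2 := by
  have hP0 : 0 ≤ P := hP.1.nonneg
  have h1 : 1 ≤ P := by
    rw [hP.2]; exact le_add_of_nonneg_of_le (transpose_mul_mul_nonneg hP0 X) hY
  have h2 : Xᵀ * P * X + Y ≤ P := hP.2.symm.le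
  obtain ⟨S, rfl⟩ := exists_eq_transpose_mul_self hP0
  rw [opNorm_transpose_mul_self] at hPp
  have hSd := isUnit_det_of_one_le h1
  have hc := opNorm_conj_le hp hPp h1 hY h2
  have hp0 : 0 < p := by linarith
  have hq : 0 ≤ 1 - 1 / p := by rw [sub_nonneg, div_le_one hp0]; exact hp
  have e1 : (Z * S⁻¹)ᵀ * (Z * S⁻¹) = (Z * S⁻¹ * (S * X * S⁻¹))ᵀ * (Z * S⁻¹ * (S * X * S⁻¹)) +
      (G * S⁻¹)ᵀ * (G * S⁻¹) := by
    have : Z * S⁻¹ * (S * X * S⁻¹) = Z * X * S⁻¹ := by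
      rw [Matrix.mul_assoc Z, ← Matrix.mul_assoc S⁻¹, ← Matrix.mul_assoc S⁻¹,
        Matrix.nonsing_inv_mul _ hSd, Matrix.one_mul, Matrix.mul_assoc]
    have := congrArg (fun M => S⁻¹ᵀ * M * S⁻¹) hZ
    simp only [Matrix.mul_add, Matrix.add_mul] at this
    rw [‹Z * S⁻¹ * (S * X * S⁻¹) = _›]
    simpa only [Matrix.transpose_mul, Matrix.mul_assoc] using this
  have e2 := hsq _ _ _ e1
  have e3 : N (Z * S⁻¹ * (S * X * S⁻¹)) ^ 2 ≤ N (Z * S⁻¹) ^ 2 * (1 - 1 / p) := by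
    rw [← Real.sq_sqrt hq, ← mul_pow]
    exact pow_le_pow_left₀ (hN.nonneg _) ((hN.mul_le_mul_opNorm _ _).trans
      (mul_le_mul_of_nonneg_left hc (hN.nonneg _))) 2
  have e4 : N (G * S⁻¹) ^ 2 ≤ N G ^ 2 :=
    pow_le_pow_left₀ (hN.nonneg _) ((hN.mul_le_mul_opNorm _ _).trans
      (mul_le_of_le_one_right (hN.nonneg _) (opNorm_inv_le_one h1))) 2
  -- One factor $p$ comes from the contraction gap $1/p$; the other, below, from undoing the
  -- normalization by $S$.
  have e5 : N (Z * S⁻¹) ^ 2 ≤ p * N G ^ 2 := by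
    have : N (Z * S⁻¹) ^ 2 * (1 - 1 / p) = N (Z * S⁻¹) ^ 2 - N (Z * S⁻¹) ^ 2 / p := by ring
    have h3 : N (Z * S⁻¹) ^ 2 / p ≤ N G ^ 2 := by linarith
    rwa [div_le_iff₀ hp0, mul_comm] at h3
  have e6 : N Z ^ 2 ≤ N (Z * S⁻¹) ^ 2 * opNorm S ^ 2 := by
    rw [← mul_pow]
    refine pow_le_pow_left₀ (hN.nonneg _) ?_ 2
    have := hN.mul_le_mul_opNorm (Z * S⁻¹) S
    rwa [Matrix.mul_assoc, Matrix.nonsing_inv_mul _ hSd, Matrix.mul_one] at this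
  calc N Z ^ 2 ≤ N (Z * S⁻¹) ^ 2 * opNorm S ^ 2 := e6
    _ ≤ p * N G ^ 2 * p := mul_le_mul e5 hPp (sq_nonneg _) (by positivity)
    _ = p ^ 2 * N G ^ 2 := by ring

theorem opNorm_sq_le_add {a b c : ℕ} (Z : Matrix (Fin a) (Fin a) ℝ) (W : Matrix (Fin b) (Fin a) ℝ)
    (G : Matrix (Fin c) (Fin a) ℝ) (h : Zᵀ * Z = Wᵀ * W + Gᵀ * G) :
    opNorm Z ^ 2 ≤ opNorm W ^ 2 + opNorm G ^ 2 := by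
  simp only [← opNorm_transpose_mul_self]
  rw [h]; exact opNorm_add_le _ _

theorem frobNorm_sq_le_add {a b c : ℕ} (Z : Matrix (Fin a) (Fin a) ℝ)
    (W : Matrix (Fin b) (Fin a) ℝ) (G : Matrix (Fin c) (Fin a) ℝ)
    (h : Zᵀ * Z = Wᵀ * W + Gᵀ * G) : frobNorm Z ^ 2 ≤ frobNorm W ^ 2 + frobNorm G ^ 2 := by
  simp only [frobNorm_sq]
  rw [h, Matrix.trace_add]

end Perturbation

/-! ### Suboptimality of a controller and the optimal cost -/

section Suboptimality

variable {dx du : ℕ} {Rx A P P' : Matrix (Fin dx) (Fin dx) ℝ} {B : Matrix (Fin dx) (Fin du) ℝ}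
  {K : Matrix (Fin du) (Fin dx) ℝ}

/-- The value of `K` is a supersolution, so some Riccati solution lies below it; uniqueness
identifies that solution with `P`. -/
theorem IsDARESolution.le_of_isLyapunovSolution (hR : 1 ≤ Rx) (h : IsDARESolution Rx 1 A B P)
    (h' : IsLyapunovSolution (A + B * K) (Rx + Kᵀ * K) P') : P ≤ P' := by
  obtain ⟨Q, hQ, hle, -⟩ := exists_isDARESolution (A := A) (B := B) (K := K)
    (zero_le_one_matrix.trans hR) h'.1.nonneg h'.2.symm.le
  rwa [h.unique hR hQ]

/-- The suboptimality of a controller, bounded by the distance to the optimal controller. -/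
theorem IsDARESolution.value_sub_le (hR : 1 ≤ Rx) (h : IsDARESolution Rx 1 A B P)
    (h' : IsLyapunovSolution (A + B * K) (Rx + Kᵀ * K) P') {p : ℝ} (hp : 1 ≤ p)
    (hP' : opNorm P' ≤ p) {T : Matrix (Fin du) (Fin du) ℝ} (hT : Tᵀ * T = 1 + Bᵀ * P * B) :
    opNorm (P' - P) ≤ p ^ 2 * opNorm (T * (K - gain A B P)) ^ 2 ∧
      P'.trace - P.trace ≤ p ^ 2 * frobNorm (T * (K - gain A B P)) ^ 2 := by
  have hY : 1 ≤ Rx + Kᵀ * K := le_add_of_le_of_nonneg hR (transpose_mul_self_nonneg K)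
  obtain ⟨Z, hZ⟩ := exists_eq_transpose_mul_self (sub_nonneg.2 (h.le_of_isLyapunovSolution hR h'))
  have hsub : Zᵀ * Z = (Z * (A + B * K))ᵀ * (Z * (A + B * K)) +
      (T * (K - gain A B P))ᵀ * (T * (K - gain A B P)) := by
    have e1 : policyMap Rx A B K P = P + (K - gain A B P)ᵀ * (Tᵀ * T) * (K - gain A B P) := by
      rw [policyMap_eq_riccatiMap_add h.nonneg, (isDARESolution_iff.1 h).2, hT]
    have e2 : policyMap Rx A B K P' = P' := h'.2.symm
    have e3 : (A + B * K)ᵀ * (P' - P) * (A + B * K) =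
        policyMap Rx A B K P' - policyMap Rx A B K P := by
      rw [policyMap, policyMap, Matrix.mul_sub, Matrix.sub_mul]; abel
    have e4 : P' - P = (A + B * K)ᵀ * (P' - P) * (A + B * K) +
        (K - gain A B P)ᵀ * (Tᵀ * T) * (K - gain A B P) := by
      rw [e3, e1, e2]; abel
    rw [hZ] at e4
    conv_lhs => rw [e4]
    rw [Matrix.transpose_mul Z, Matrix.transpose_mul T]
    simp only [Matrix.mul_assoc]
  -- With $P' - P = Z^\top Z$, the spectral norm and the trace become the squared spectral and
  -- Frobenius norms of $Z$.
  rw [hZ, opNorm_transpose_mul_self, ← Matrix.trace_sub, hZ, ← frobNorm_sq]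
  exact ⟨isOperatorIdealNorm_opNorm.sq_le_of_lyapunov opNorm_sq_le_add hY h' hp hP' hsub,
    isOperatorIdealNorm_frobNorm.sq_le_of_lyapunov frobNorm_sq_le_add hY h' hp hP' hsub⟩

theorem exists_isDARESolution_of_stabilizable (hR : 1 ≤ Rx) (h : Stabilizable A B) :
    ∃ P, IsDARESolution Rx 1 A B P := by
  obtain ⟨K, hK⟩ := h
  have hR0 := zero_le_one_matrix.trans hR
  obtain ⟨U, hU0, hU⟩ := exists_lyapunov_le hK (add_nonneg hR0 (transpose_mul_self_nonneg K))
  obtain ⟨P, hP, -⟩ := exists_isDARESolution hR0 hU0 hU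
  exact ⟨P, hP⟩

theorem IsDARESolution.pinf_eq (hR : 1 ≤ Rx) (h : IsDARESolution Rx 1 A B P) :
    Pinf Rx 1 A B = P :=
  (Classical.epsilon_spec (p := IsDARESolution Rx 1 A B) ⟨P, h⟩).unique hR h

theorem IsDARESolution.kinf_eq (hR : 1 ≤ Rx) (h : IsDARESolution Rx 1 A B P) :
    Kinf Rx 1 A B = gain A B P := by
  rw [Kinf, h.pinf_eq hR, gain]

theorem IsLyapunovSolution.dlyap_eq {X Y : Matrix (Fin dx) (Fin dx) ℝ} (hY : 1 ≤ Y)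
    (h : IsLyapunovSolution X Y P) : dlyap X Y = P :=
  (Classical.epsilon_spec (p := IsLyapunovSolution X Y) ⟨P, h⟩).unique hY h

theorem isStable_of_policyMap_le (hR : 1 ≤ Rx) {U : Matrix (Fin dx) (Fin dx) ℝ} (hU0 : 0 ≤ U)
    (hU : policyMap Rx A B K U ≤ U) : IsStable (A + B * K) :=
  isStable_of_lyapunov_le hU0 (le_add_of_le_of_nonneg hR (transpose_mul_self_nonneg K)) hU

/-- The greedy controller attains the trace because its finite-horizon values converge to `P`. Value
iteration also converges to `P` and lies below the finite-horizon values of every controller,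
stabilizing or not. -/
theorem IsDARESolution.isOptimalCost (hR : 1 ≤ Rx) (h : IsDARESolution Rx 1 A B P) :
    IsOptimalCost Rx 1 A B P.trace := by
  have hR0 := zero_le_one_matrix.trans hR
  constructor
  · obtain ⟨Q, hQ, -, hlim⟩ := exists_isLyapunovSolution
      (X := A + B * gain A B P) (Y := Rx + (gain A B P)ᵀ * gain A B P)
      (add_nonneg hR0 (transpose_mul_self_nonneg _)) h.nonneg h.policyMap_gain.le
    have hPl : IsLyapunovSolution (A + B * gain A B P) (Rx + (gain A B P)ᵀ * gain A B P) P :=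
      ⟨h.1, h.policyMap_gain.symm⟩
    rw [← hPl.unique (le_add_of_le_of_nonneg hR (transpose_mul_self_nonneg _)) hQ] at hlim
    exact ⟨_, hasAverageCost_of_tendsto hlim⟩
  · rintro J ⟨K, hK⟩
    obtain ⟨Q, hQ, -, hlim⟩ := exists_isDARESolution (A := A) (B := B) hR0 h.nonneg
      h.policyMap_gain.le
    rw [← h.unique hR hQ] at hlim
    exact trace_le_of_hasAverageCost hR0 hlim hK

/-- Positive dimension is essential: the identity of size zero has norm $0$. -/
theorem one_le_opNorm (hdx : 0 < dx) (h : 1 ≤ P) : 1 ≤ opNorm P := by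
  have : Nonempty (Fin dx) := ⟨⟨0, hdx⟩⟩
  have h1 : opNorm (1 : Matrix (Fin dx) (Fin dx) ℝ) = 1 := by
    open scoped Matrix.Norms.L2Operator in exact norm_one
  exact h1.symm.le.trans (opNorm_mono zero_le_one_matrix h)

theorem opNorm_inv_smul_le {p c δ : ℝ} (hPp : opNorm P ≤ p) (hδ1 : δ < 1)
    (hc : 1 ≤ c * (1 - δ)) :
    opNorm ((1 - δ)⁻¹ • P) ≤ c * p := by
  have h1 : 0 < 1 - δ := by linarith
  rw [opNorm_smul, abs_of_pos (inv_pos.2 h1)]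
  refine mul_le_mul ?_ hPp (opNorm_nonneg _) ?_
  · rwa [inv_le_iff_one_le_mul₀ h1]
  · exact nonneg_of_mul_nonneg_left (by linarith) h1

end Suboptimality

/-- Numerical consequences of the smallness of the perturbation. -/
theorem small_perturbation_bounds {p ε : ℝ} (hp : 1 ≤ p) (hε : 0 ≤ ε)
    (h : ε ≤ 1 / (54 * p ^ 5)) :
    p ^ 2 * ε ≤ 1 / 54 ∧ p ^ 2 * ε ^ 2 ≤ 1 / 2916 ∧ p ^ 8 * ε ^ 2 ≤ 1 / 2916 ∧
      p ^ 2 * ε ≤ 1 / (54 * p ^ (3 / 2 : ℝ)) := by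
  have hp0 : 0 < p := by linarith
  have h5 : p ^ 5 * ε ≤ 1 / 54 := by
    rw [le_div_iff₀ (by positivity)] at h
    linarith
  have h2 : p ^ 2 * ε ≤ p ^ 5 * ε :=
    mul_le_mul_of_nonneg_right (pow_le_pow_right₀ hp (by norm_num)) hε
  have h4 : p ^ 4 * ε ≤ p ^ 5 * ε :=
    mul_le_mul_of_nonneg_right (pow_le_pow_right₀ hp (by norm_num)) hε
  have h1 : p ^ 1 * ε ≤ p ^ 5 * ε :=
    mul_le_mul_of_nonneg_right (pow_le_pow_right₀ hp (by norm_num)) hε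
  have hsq : ∀ {x : ℝ}, 0 ≤ x → x ≤ 1 / 54 → x ^ 2 ≤ 1 / 2916 := fun h0 hx =>
    (pow_le_pow_left₀ h0 hx 2).trans (by norm_num)
  refine ⟨h2.trans h5, ?_, ?_, ?_⟩
  · have := hsq (by positivity) (h1.trans h5)
    rwa [mul_pow, pow_one] at this
  · have := hsq (by positivity) (h4.trans h5)
    rwa [mul_pow, ← pow_mul] at this
  -- Rounding $3/2$ up to $3$ uses exactly the available power $p^5$.
  · have h3 : p ^ (3 / 2 : ℝ) ≤ p ^ 3 := by
      rw [← Real.rpow_natCast]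
      exact Real.rpow_le_rpow_of_exponent_le hp (by norm_num)
    rw [le_div_iff₀ (by positivity)]
    calc p ^ 2 * ε * (54 * p ^ (3 / 2 : ℝ)) ≤ p ^ 2 * ε * (54 * p ^ 3) := by gcongr
      _ = 54 * (p ^ 5 * ε) := by ring
      _ ≤ 1 := by linarith

end LQR

/-! ### The main theorem: assembly and constants -/

open LQR MatrixOrder in
theorem theorem3 :
    ∃ C : ℝ, 0 < C ∧
      ∀ (dx du : ℕ) (_ : 0 < dx)
        (Rx : Matrix (Fin dx) (Fin dx) ℝ) (_ : LQR.LoewnerLE 1 Rx)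
        (Ru : Matrix (Fin du) (Fin du) ℝ) (_ : Ru = 1)
        (As Ah : Matrix (Fin dx) (Fin dx) ℝ) (Bs Bh : Matrix (Fin dx) (Fin du) ℝ)
        (Ps Ph : Matrix (Fin dx) (Fin dx) ℝ) (Ks Kh : Matrix (Fin du) (Fin dx) ℝ)
        (eop eF : ℝ)
        (_ : Ps = LQR.Pinf Rx Ru As Bs) (_ : Ks = LQR.Kinf Rx Ru As Bs)
        (_ : Ph = LQR.Pinf Rx Ru Ah Bh) (_ : Kh = LQR.Kinf Rx Ru Ah Bh)
        (_ : eop = max (LQR.opNorm (Ah - As)) (LQR.opNorm (Bh - Bs)))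
        (_ : eF = max (LQR.frobNorm (Ah - As)) (LQR.frobNorm (Bh - Bs)))
        (_ : LQR.Stabilizable As Bs)
        (_ : eop ≤ 1 / (54 * LQR.opNorm Ps ^ 5)),
        -- all objects below are well defined
        (∃! P, LQR.IsDARESolution Rx Ru As Bs P) ∧
        LQR.Stabilizable Ah Bh ∧
        (∃! P, LQR.IsDARESolution Rx Ru Ah Bh P) ∧
        LQR.IsStable (As + Bs * Kh) ∧
        (∃! P, LQR.IsLyapunovSolution (As + Bs * Kh) (Rx + Khᵀ * Ru * Kh) P) ∧
        -- the perturbation of the Riccati solution and of the controller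
        LQR.opNorm Ph ≤ 1.0835 * LQR.opNorm Ps ∧
        LQR.opNorm (Bs * (Ks - Kh)) < 1 / (5 * LQR.opNorm Ps ^ (3 / 2 : ℝ)) ∧
        LQR.opNorm (Ks - Kh) ≤ C * (1 / LQR.opNorm Ps ^ (3 / 2 : ℝ)) ∧
        -- the suboptimality of the certainty-equivalent controller
        (∃ J Jstar : ℝ, LQR.HasAverageCost Rx Ru As Bs Kh J ∧
          LQR.IsOptimalCost Rx Ru As Bs Jstar ∧
          J - Jstar ≤ 142 * LQR.opNorm Ps ^ 8 * eF ^ 2) ∧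
        -- the perturbation of the value matrix
        LQR.opNorm (LQR.PinfOf Rx Ru As Bs Kh - Ps) ≤ 142 * LQR.opNorm Ps ^ 8 * eop ^ 2 ∧
        LQR.LoewnerLE (LQR.PinfOf Rx Ru As Bs Kh) ((21 / 20 : ℝ) • Ps) := by
  -- Both $B_\star^\top B_\star$ and $I$ lie below $T^\top T$, so the constant for $B_\star(K_\star
  -- - \hat K)$ also serves for $K_\star - \hat K$.
  refine ⟨1 / 5, by norm_num, ?_⟩
  rintro dx du hdx Rx hR Ru rfl As Ah Bs Bh Ps Ph Ks Kh eop eF hPs hKs hPh hKh heop heF hstab hsmall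
  replace hR : 1 ≤ Rx := hR
  have hR0 := zero_le_one_matrix.trans hR
  obtain ⟨P, hP⟩ := exists_isDARESolution_of_stabilizable hR hstab
  rw [hP.pinf_eq hR] at hPs
  rw [hP.kinf_eq hR] at hKs
  subst hPs
  set p := opNorm Ps with hp_def
  have hp : 1 ≤ p := one_le_opNorm hdx (hP.one_le hR)
  have hp0 : 0 < p := by linarith
  have hA : opNorm (Ah - As) ≤ eop := heop ▸ le_max_left _ _
  have hB : opNorm (Bh - Bs) ≤ eop := heop ▸ le_max_right _ _
  have hAF : frobNorm (Ah - As) ≤ eF := heF ▸ le_max_left _ _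
  have hBF : frobNorm (Bh - Bs) ≤ eF := heF ▸ le_max_right _ _
  have he0 : 0 ≤ eop := (opNorm_nonneg _).trans hA
  have heF0 : 0 ≤ eF := (frobNorm_nonneg _).trans hAF
  obtain ⟨b1, b2, b3, b4⟩ := small_perturbation_bounds hp he0 hsmall
  -- the perturbed Riccati solution
  have hU := hP.policyMap_smul_le (A' := Ah) (B' := Bh) (δ := 220 / 2916) hR hp hp_def.symm.ge
    hA hB (by linarith) (by norm_num)
  -- Here $220/2916 = 4/54 + 4/2916$ bounds $4p^2\epsilon + 4p^2\epsilon^2$, and $1/(1 - 220/2916) <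
  -- 1.0835$.
  have hU0 := smul_nonneg_of_nonneg (r := (1 - 220 / 2916 : ℝ)⁻¹) (by norm_num) hP.nonneg
  obtain ⟨P', hP', hP'U, -⟩ := exists_isDARESolution hR0 hU0 hU
  rw [hP'.pinf_eq hR] at hPh
  rw [hP'.kinf_eq hR] at hKh
  subst hPh
  have hPhn : opNorm Ph ≤ 1.0835 * p := (opNorm_mono hP'.nonneg hP'U).trans
    (opNorm_inv_smul_le le_rfl (by norm_num) (by norm_num))
  -- the value matrix of the certainty-equivalent controller
  set q := 1.0835 * p with hq_def
  have hq : 1 ≤ q := by linarith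
  -- The systems exchange roles, with $q$ for $p$: $1.0835^2 \cdot 220/2916 < 0.0887$. The resulting
  -- inflation is below $1.0975$, and $1.0975 \cdot 1.0835 < 1.2$.
  have hW := hP'.policyMap_smul_le (A' := As) (B' := Bs) (δ := 0.0887) (ε := eop) hR hq hPhn
    (by rwa [← neg_sub, opNorm_neg]) (by rwa [← neg_sub, opNorm_neg])
    (by rw [hq_def, mul_pow]; linarith) (by norm_num)
  have hW0 := smul_nonneg_of_nonneg (r := (1 - 0.0887 : ℝ)⁻¹) (by norm_num) hP'.nonneg
  rw [← hKh] at hW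
  have hstable := isStable_of_policyMap_le hR hW0 hW
  have hY : 1 ≤ Rx + Khᵀ * Kh := le_add_of_le_of_nonneg hR (transpose_mul_self_nonneg Kh)
  obtain ⟨V, hV, hVW, hVlim⟩ := exists_isLyapunovSolution (zero_le_one_matrix.trans hY) hW0 hW
  have hVn : opNorm V ≤ 1.2 * p := by
    refine ((opNorm_mono hV.1.nonneg hVW).trans (opNorm_inv_smul_le (c := 1.0975) hPhn
      (by norm_num) (by norm_num))).trans ?_
    rw [hq_def]; linarith
  have hVeq : PinfOf Rx 1 As Bs Kh = V := by
    rw [PinfOf, Matrix.mul_one]; exact hV.dlyap_eq hY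
  -- the controller
  obtain ⟨T, hT⟩ := exists_eq_transpose_mul_self (posDef_one_add hP.nonneg Bs).posSemidef.nonneg
  have hs : 1 ≤ √q := Real.one_le_sqrt.2 hq
  have hs2 : √q ^ 2 = q := Real.sq_sqrt (by linarith)
  have hs4 : √q ^ 4 = q ^ 2 := by
    rw [show 4 = 2 * 2 from rfl, pow_mul, hs2]
  have hpq : opNorm Ps ≤ √q ^ 2 := by rw [hs2]; linarith
  have hqq : opNorm Ph ≤ √q ^ 2 := by rwa [hs2]
  have hTop := (isOperatorIdealNorm_opNorm.perturbation hR hP hP' hs hpq hqq hA hB).2 T hT.symm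
  have hTF := (isOperatorIdealNorm_frobNorm.perturbation hR hP hP' hs hpq hqq hAF hBF).2 T hT.symm
  have hvop := (hP.value_sub_le hR hV (by linarith) hVn hT.symm).1
  have hvF := (hP.value_sub_le hR hV (by linarith) hVn hT.symm).2
  rw [← hKs, ← hKh, hs4] at hTop hTF
  rw [← hKs] at hvop hvF
  -- The constant obtained is $1.2^2 \cdot 49 \cdot 1.0835^4 < 98$ with the power $p^6$, so
  -- $142\,p^8$ leaves room.
  have hquad : ∀ {x e : ℝ}, 0 ≤ x → x ≤ 7 * q ^ 2 * e →
      (1.2 * p) ^ 2 * x ^ 2 ≤ 142 * p ^ 8 * e ^ 2 := by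
    intro x e hx hxe
    calc (1.2 * p) ^ 2 * x ^ 2 ≤ (1.2 * p) ^ 2 * (7 * q ^ 2 * e) ^ 2 := by gcongr
      _ = (1.2 ^ 2 * 49 * 1.0835 ^ 4) * (p ^ 6 * e ^ 2) := by rw [hq_def]; ring
      _ ≤ 142 * (p ^ 8 * e ^ 2) := by
        gcongr
        · norm_num
        · norm_num
      _ = 142 * p ^ 8 * e ^ 2 := by ring
  have hvalue : opNorm (V - Ps) ≤ 142 * p ^ 8 * eop ^ 2 :=
    hvop.trans (hquad (opNorm_nonneg _) hTop)
  have hR1 : 1 ≤ Tᵀ * T := by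
    rw [← hT]; exact le_add_of_nonneg_right (transpose_mul_mul_nonneg hP.nonneg Bs)
  have hTd := isUnit_det_of_one_le hR1
  have hr0 : 0 < p ^ (3 / 2 : ℝ) := Real.rpow_pos_of_pos hp0 _
  have hKsmall : opNorm (T * (Kh - Ks)) < 1 / (5 * p ^ (3 / 2 : ℝ)) := by
    refine hTop.trans_lt ?_
    -- $7 \cdot 1.0835^2 < 8.3$, and $8.3/54 < 1/5$ gives the strict bound.
    have e1 : 7 * q ^ 2 * eop ≤ 8.3 * (1 / (54 * p ^ (3 / 2 : ℝ))) := by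
      rw [hq_def, mul_pow]
      have : 0 ≤ p ^ 2 * eop := by positivity
      linarith
    refine e1.trans_lt ?_
    rw [mul_one_div, div_lt_div_iff₀ (by positivity) (by positivity)]
    linarith
  have hdom : ∀ {m : ℕ} (X : Matrix (Fin m) (Fin du) ℝ), Xᵀ * X ≤ Tᵀ * T →
      opNorm (X * (Ks - Kh)) ≤ opNorm (T * (Kh - Ks)) := by
    intro m X hX
    have h1 : opNorm (X * T⁻¹) ≤ 1 := opNorm_mul_inv_le zero_le_one hTd (by simpa using hX)
    have h2 : X * (Ks - Kh) = -(X * T⁻¹ * (T * (Kh - Ks))) := by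
      rw [Matrix.mul_assoc, Matrix.nonsing_inv_mul_cancel_left _ _ hTd, ← Matrix.mul_neg, neg_sub]
    rw [h2, opNorm_neg]
    exact (opNorm_mul_le _ _).trans (mul_le_of_le_one_left (opNorm_nonneg _) h1)
  have hBX : Bsᵀ * Bs ≤ Tᵀ * T := by
    rw [← hT]
    have := transpose_mul_mul_mono (hP.one_le hR) Bs
    rw [Matrix.mul_one] at this
    exact this.trans (le_add_of_nonneg_left zero_le_one_matrix)
  refine ⟨⟨Ps, hP, fun Q hQ => hQ.unique hR hP⟩, ⟨_, isStable_of_policyMap_le hR hU0 hU⟩,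
    ⟨Ph, hP', fun Q hQ => hQ.unique hR hP'⟩, hstable, ?_, hPhn, (hdom Bs hBX).trans_lt hKsmall,
    ?_, ⟨V.trace, Ps.trace, hasAverageCost_of_tendsto hVlim, hP.isOptimalCost hR,
      hvF.trans (hquad (frobNorm_nonneg _) hTF)⟩, ?_, ?_⟩
  · rw [Matrix.mul_one]
    exact ⟨V, hV, fun Q hQ => hQ.unique hY hV⟩
  · have h1 := hdom (1 : Matrix (Fin du) (Fin du) ℝ) (by simpa using hR1)
    rw [Matrix.one_mul] at h1
    refine (h1.trans hKsmall.le).trans (le_of_eq ?_)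
    rw [one_div_mul_one_div]
  · rwa [hVeq]
  · rw [hVeq]
    change V ≤ (21 / 20 : ℝ) • Ps
    have hsymm : (V - Ps)ᵀ = V - Ps := by
      rw [Matrix.transpose_sub, transpose_eq_of_nonneg hV.1.nonneg,
        transpose_eq_of_nonneg hP.nonneg]
    -- Smallness gives $142\,p^8\epsilon^2 \le 142/2916 < 1/20$; then $I \preceq P_\star$ makes the
    -- bound multiplicative.
    have h1 : V - Ps ≤ (1 / 20 : ℝ) • 1 := (le_opNorm_smul_one hsymm).trans
      (smul_le_smul_right (by linarith) zero_le_one_matrix)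
    have h2 := h1.trans (smul_le_smul_left (by norm_num) (hP.one_le hR))
    rw [sub_le_iff_le_add] at h2
    refine h2.trans (le_of_eq ?_)
    rw [show (21 / 20 : ℝ) = 1 / 20 + 1 by norm_num, add_smul, one_smul]
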